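/- Consider the trihexagonal tiling of the Euclidean plane with edges of unit length, in which a regular hexagon and an equilateral triangle meet at each edge. A *trajectory* of tiling billiards on it starts at an interior point of an edge, moves in a straight line inside each tile, and, each time it meets an edge (always at an interior point of that edge, never at a vertex), passes into the neighbouring tile in the direction for which its new line is the reflection of its old line across that edge (refraction coefficient $-1$: the component of the direction normal to the edge is kept, the component along the edge changes sign). Trajectories continue for infinitely many crossings. There exists a trajectory that is dense in an infinite region of the plane: there are an infinite trajectory $\tau\subset\mathbb{R}^2$ and a connected open set $R\subset\mathbb{R}^2$ of infinite area such that $R\subseteq\overline{\tau}$. -/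

import Mathlib

namespace Trihexagonal

/-- The primitive sixth root of unity `1/2 + (√3/2) i`. The Euclidean plane is `ℂ`. -/
noncomputable def zeta : ℂ := ⟨1 / 2, Real.sqrt 3 / 2⟩

/-- The `k`-th vertex of the regular hexagon of side `1` centred at the point `2 a + 2 b ζ`
of the triangular lattice. -/
noncomputable def vertex (a b : ℤ) (k : ℕ) : ℂ := 2 * a + 2 * b * zeta + zeta ^ k

/-- The index of an edge of the tiling: the hexagon it belongs to, and its position there.
Two different hexagons of the tiling share no edge, and every edge bounds exactly one hexagon
(and one triangle), so this lists every edge exactly once. -/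
abbrev EdgeIndex : Type := ℤ × ℤ × Fin 6

/-- First endpoint of an edge. -/
noncomputable def edgeStart (e : EdgeIndex) : ℂ := vertex e.1 e.2.1 (e.2.2 : ℕ)

/-- Second endpoint of an edge. -/
noncomputable def edgeEnd (e : EdgeIndex) : ℂ := vertex e.1 e.2.1 ((e.2.2 : ℕ) + 1)

/-- The union of all (closed, unit length) edges of the trihexagonal tiling. The components of
its complement are the open tiles: the regular hexagons centred at the points `2 a + 2 b ζ`,
and the equilateral triangles that fill the gaps between them. -/
def skeleton : Set ℂ := ⋃ e : EdgeIndex, segment ℝ (edgeStart e) (edgeEnd e)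

/-- The direction in which a ray of direction `v` continues after crossing the edge `e`
(refraction coefficient `-1`): the line of the ray is reflected across the line of the edge, and
the ray passes to the other side. So the component of `v` normal to the edge is kept, and the
component along the edge changes sign. -/
noncomputable def refract (e : EdgeIndex) (v : ℂ) : ℂ :=
  -((Submodule.span ℝ {edgeEnd e - edgeStart e}).reflection v)

/-- A tiling billiards trajectory on the trihexagonal tiling, given by its successive
intersections `p 0, p 1, p 2, …` with the edges. It never hits a vertex. -/
structure IsTrajectory (p : ℕ → ℂ) : Prop where
  /-- every `p i` is an interior point of some edge -/
  mem_edge : ∀ i, ∃ e, p i ∈ openSegment ℝ (edgeStart e) (edgeEnd e)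
  ne : ∀ i, p i ≠ p (i + 1)
  /-- between `p i` and `p (i + 1)` the trajectory stays inside one open tile -/
  inside_tile : ∀ i, Disjoint (openSegment ℝ (p i) (p (i + 1))) skeleton
  /-- the trajectory is refracted at every edge that it crosses -/
  refracted : ∀ i e, p (i + 1) ∈ openSegment ℝ (edgeStart e) (edgeEnd e) →
    SameRay ℝ (refract e (p (i + 1) - p i)) (p (i + 2) - p (i + 1))

/-- The set of points of the plane that lie on the trajectory. -/
def trace (p : ℕ → ℂ) : Set ℂ := ⋃ i, segment ℝ (p i) (p (i + 1))

end Trihexagonal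

namespace Trihexagonal

open Finset

/-- The primitive cube root of unity `ζ²`. -/
noncomputable def omega : ℂ := zeta ^ 2

theorem zeta_sq : zeta ^ 2 = zeta - 1 := by
  have h : Real.sqrt 3 * Real.sqrt 3 = 3 := Real.mul_self_sqrt (by norm_num)
  apply Complex.ext <;> simp [zeta, pow_two] <;> nlinarith

theorem zeta_eq : zeta = 1 + omega := by
  rw [omega, zeta_sq]; ring

theorem omega_sq : omega ^ 2 = -1 - omega := by
  have h := zeta_sq
  rw [omega]
  linear_combination (zeta ^ 2 + zeta + 1) * h

theorem omega_cube : omega ^ 3 = 1 := by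
  linear_combination (omega - 1) * omega_sq

theorem omega_pow_eq {m n : ℕ} (h : m % 3 = n % 3) : omega ^ m = omega ^ n := by
  rw [← Nat.div_add_mod m 3, ← Nat.div_add_mod n 3, h]
  simp [pow_add, pow_mul, omega_cube]

/-- Membership in the ring `ℤ[ω]` of Eisenstein integers. -/
def IsEisenstein (z : ℂ) : Prop := ∃ i j : ℤ, z = i + j * omega

theorem IsEisenstein.add {z w : ℂ} (hz : IsEisenstein z) (hw : IsEisenstein w) :
    IsEisenstein (z + w) := by
  obtain ⟨i, j, rfl⟩ := hz
  obtain ⟨i', j', rfl⟩ := hw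
  exact ⟨i + i', j + j', by push_cast; ring⟩

theorem IsEisenstein.mul {z w : ℂ} (hz : IsEisenstein z) (hw : IsEisenstein w) :
    IsEisenstein (z * w) := by
  obtain ⟨i, j, rfl⟩ := hz
  obtain ⟨i', j', rfl⟩ := hw
  refine ⟨i * i' - j * j', i * j' + j * i' - j * j', ?_⟩
  push_cast
  linear_combination (j : ℂ) * j' * omega_sq

theorem isEisenstein_intCast (i : ℤ) : IsEisenstein i := ⟨i, 0, by simp⟩

theorem isEisenstein_omega : IsEisenstein omega := ⟨0, 1, by simp⟩

theorem isEisenstein_one : IsEisenstein 1 := ⟨1, 0, by simp⟩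

theorem isEisenstein_omega_pow (n : ℕ) : IsEisenstein (omega ^ n) := by
  induction n with
  | zero => simpa using isEisenstein_one
  | succ n ih => rw [pow_succ]; exact ih.mul isEisenstein_omega

/-- Any two Eisenstein integers differ by a sum of nonnegative multiples of cube roots of unity. -/
theorem IsEisenstein.exists_nat_combination {z w : ℂ} (hz : IsEisenstein z)
    (hw : IsEisenstein w) :
    ∃ a b c : ℕ, w = z + a + b * omega + c * omega ^ 2 := by
  obtain ⟨i, j, rfl⟩ := hz
  obtain ⟨i', j', rfl⟩ := hw
  obtain ⟨N, hN1, hN2⟩ : ∃ N : ℕ, 0 ≤ i' - i + N ∧ 0 ≤ j' - j + N :=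
    ⟨(i' - i).natAbs + (j' - j).natAbs, by omega, by omega⟩
  obtain ⟨a, ha⟩ := Int.eq_ofNat_of_zero_le hN1
  obtain ⟨b, hb⟩ := Int.eq_ofNat_of_zero_le hN2
  refine ⟨a, b, N, ?_⟩
  have ha' : (i' - i + N : ℂ) = a := by exact_mod_cast ha
  have hb' : (j' - j + N : ℂ) = b := by exact_mod_cast hb
  rw [← ha', ← hb', omega_sq]
  ring

section PeriodSum

theorem sum_omega_pow (m : ℕ) : ∑ k ∈ range (3 * m), omega ^ k = 0 := by
  induction m with
  | zero => simp
  | succ m ih =>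
    rw [show 3 * (m + 1) = 3 * m + 1 + 1 + 1 by ring, sum_range_succ, sum_range_succ,
      sum_range_succ, ih, pow_succ _ (3 * m + 1), pow_succ _ (3 * m)]
    linear_combination omega ^ (3 * m) * omega_sq

theorem sum_mul_omega_pow (m : ℕ) :
    ∑ k ∈ range (3 * m), omega ^ k * (k : ℂ) = m * (omega + 2 * omega ^ 2) := by
  induction m with
  | zero => simp
  | succ m ih =>
    rw [show 3 * (m + 1) = 3 * m + 1 + 1 + 1 by ring, sum_range_succ, sum_range_succ,
      sum_range_succ, ih, pow_succ _ (3 * m + 1), pow_succ _ (3 * m), pow_mul, omega_cube]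
    push_cast
    simp only [one_pow]
    linear_combination (3 * m : ℂ) * omega_sq

theorem sum_omega_pow_mul_emod {m : ℕ} (hm : 0 < m) {p : ℤ} (hp : p % 3 = 1)
    (hpq : IsCoprime p ((3 * m : ℕ) : ℤ)) (R : ℤ) (e : ℕ) (he : (R + e) % 3 = 0) :
    ∑ k ∈ range (3 * m), omega ^ k * (((R + k * p) % ((3 * m : ℕ) : ℤ) : ℤ) : ℂ) =
      omega ^ e * (m * (omega + 2 * omega ^ 2)) := by
  set q : ℕ := 3 * m with hq
  have hq0 : (0 : ℤ) < q := by omega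
  have hnn : ∀ k : ℕ, 0 ≤ (R + k * p) % (q : ℤ) := fun k => Int.emod_nonneg _ hq0.ne'
  have hlt : ∀ k : ℕ, (R + k * p) % (q : ℤ) < q := fun k => Int.emod_lt_of_pos _ hq0
  have hmaps : Set.MapsTo (fun k : ℕ => ((R + k * p) % (q : ℤ)).toNat) (range q) (range q) := by
    intro k _
    have h1 := hnn k
    have h2 := hlt k
    simp only [coe_range, Set.mem_Iio]
    omega
  have hinj : Set.InjOn (fun k : ℕ => ((R + k * p) % (q : ℤ)).toNat) (range q) := by
    intro k hk l hl hkl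
    have h1 : (R + k * p) % (q : ℤ) = (R + l * p) % (q : ℤ) := by
      have := hnn k
      have := hnn l
      simp only at hkl
      omega
    have h2 : (q : ℤ) ∣ (l - k : ℤ) * p := by
      have := Int.ModEq.dvd h1
      rwa [show R + l * p - (R + k * p) = ((l : ℤ) - k) * p by ring] at this
    have h3 : (q : ℤ) ∣ (l - k : ℤ) := hpq.symm.dvd_of_dvd_mul_right h2
    simp only [coe_range, Set.mem_Iio] at hk hl
    have h4 := Int.eq_zero_of_abs_lt_dvd h3 (by rw [abs_lt]; constructor <;> omega)
    omega
  have hsurj := surjOn_of_injOn_of_card_le _ hmaps hinj le_rfl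
  rw [← sum_mul_omega_pow, mul_sum]
  refine sum_nbij _ hmaps hinj hsurj ?_
  intro k _
  have h1 := hnn k
  have hcast : ((((R + k * p) % (q : ℤ)).toNat : ℕ) : ℂ) = (((R + k * p) % (q : ℤ) : ℤ) : ℂ) := by
    have : ((((R + k * p) % (q : ℤ)).toNat : ℕ) : ℤ) = (R + k * p) % (q : ℤ) := Int.toNat_of_nonneg h1
    exact_mod_cast congrArg (Int.cast : ℤ → ℂ) this
  rw [hcast, ← mul_assoc, ← pow_add]
  congr 1
  apply omega_pow_eq
  have h2 : (R + k * p) % (q : ℤ) % 3 = (R + k * p) % 3 :=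
    Int.emod_emod_of_dvd _ ⟨m, by rw [hq]; push_cast; ring⟩
  have h3 : (k * p) % 3 = (k : ℤ) % 3 := by rw [Int.mul_emod, hp]; simp
  omega

/-- The `ω`-weighted sum of a period of a rational Sturmian sequence is a cube root of unity. -/
theorem sum_omega_pow_mul_div {m : ℕ} (hm : 0 < m) {p : ℤ} (hp : p % 3 = 1)
    (hpq : IsCoprime p ((3 * m : ℕ) : ℤ)) (R : ℤ) (e : ℕ) (he : (R + e) % 3 = 2) :
    ∑ k ∈ range (3 * m), omega ^ k *
      (((R + (k + 1 : ℕ) * p) / ((3 * m : ℕ) : ℤ) - (R + k * p) / ((3 * m : ℕ) : ℤ) : ℤ) : ℂ) =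
      omega ^ e := by
  set q : ℕ := 3 * m with hq
  have hq0 : (q : ℂ) ≠ 0 := by
    have : q ≠ 0 := by omega
    exact_mod_cast this
  set r : ℕ → ℂ := fun k => (((R + k * p) % (q : ℤ) : ℤ) : ℂ) with hr
  have hdiv : ∀ k : ℕ, (q : ℂ) * (((R + k * p) / (q : ℤ) : ℤ) : ℂ) = R + k * p - r k := by
    intro k
    have h : (q : ℤ) * ((R + k * p) / (q : ℤ)) = R + k * p - (R + k * p) % (q : ℤ) := by
      linarith [Int.mul_ediv_add_emod (R + k * p) q]
    have h' := congrArg (Int.cast : ℤ → ℂ) h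
    push_cast at h' ⊢
    simpa [hr] using h'
  have hsum : ∑ k ∈ range q, omega ^ k * r k =
      omega ^ (e + 1) * (m * (omega + 2 * omega ^ 2)) :=
    sum_omega_pow_mul_emod hm hp hpq R (e + 1) (by push_cast; omega)
  have hshift : ∑ k ∈ range q, omega ^ (k + 1) * r (k + 1) = ∑ k ∈ range q, omega ^ k * r k := by
    have h1 := sum_range_succ' (fun k => omega ^ k * r k) q
    have h2 := sum_range_succ (fun k => omega ^ k * r k) q
    have h3 : r q = r 0 := by
      simp only [hr]
      congr 1
      rw [mul_comm (q : ℤ) p]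
      simp
    have h4 : omega ^ q = 1 := by rw [hq, pow_mul, omega_cube, one_pow]
    simp only [h3, h4, pow_zero] at h1 h2
    linear_combination h2 - h1
  have h0 : ∑ k ∈ range q, omega ^ k = 0 := sum_omega_pow m
  apply mul_left_cancel₀ hq0
  have key : (q : ℂ) * ∑ k ∈ range q, omega ^ k *
      (((R + (k + 1 : ℕ) * p) / (q : ℤ) - (R + k * p) / (q : ℤ) : ℤ) : ℂ) =
      p * ∑ k ∈ range q, omega ^ k + ∑ k ∈ range q, omega ^ k * r k
        - omega ^ 2 * ∑ k ∈ range q, omega ^ (k + 1) * r (k + 1) := by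
    simp only [mul_sum]
    rw [← sum_add_distrib, ← sum_sub_distrib]
    refine sum_congr rfl fun k _ => ?_
    have e1 := hdiv k
    have e2 := hdiv (k + 1)
    push_cast at e1 e2 ⊢
    linear_combination omega ^ k * (e2 - e1) + omega ^ k * r (k + 1) * omega_cube
  rw [key, hshift, h0, hsum]
  rw [hq]
  push_cast
  rw [pow_succ]
  linear_combination (omega ^ e * m * (-2 * omega ^ 3 + omega ^ 2 + 3 * omega - 3)) * omega_sq

end PeriodSum

/-- The number of integers passed by the arithmetic progression of start `θ.2` and
difference `θ.1` before its `k`-th term. -/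
noncomputable def height (θ : ℝ × ℝ) (k : ℕ) : ℤ := ⌊θ.2 + k * θ.1⌋

/-- Half the centre of the hexagon that is reached after `n` steps by a trajectory whose slope
and offset are given by `θ`. -/
noncomputable def cocycle (θ : ℝ × ℝ) (n : ℕ) : ℂ :=
  ∑ k ∈ range n, omega ^ k * (1 + omega * ((height θ (k + 1) - height θ k : ℤ) : ℂ))

/-- The parameters whose trajectory is in the hexagon of centre `2 z` after some number of steps
congruent to `c` modulo `3`, with an offset between `a` and `b`. -/
def visit (c : ℕ) (a b : ℝ) (z : ℂ) : Set (ℝ × ℝ) :=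
  {θ | ∃ n : ℕ, n % 3 = c ∧ cocycle θ n = z ∧ Int.fract (θ.2 + n * θ.1) ∈ Set.Ioo a b ∧
    ∀ k ≤ n, ∀ j : ℤ, θ.2 + k * θ.1 ≠ j}

theorem isEisenstein_cocycle (θ : ℝ × ℝ) (n : ℕ) : IsEisenstein (cocycle θ n) := by
  induction n with
  | zero => exact ⟨0, 0, by simp [cocycle]⟩
  | succ n ih =>
    rw [cocycle, sum_range_succ]
    exact ih.add ((isEisenstein_omega_pow n).mul
      (isEisenstein_one.add (isEisenstein_omega.mul (isEisenstein_intCast _))))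

theorem eventually_floor_eq {f : ℝ × ℝ → ℝ} (hf : Continuous f) {θ : ℝ × ℝ}
    (h : ∀ j : ℤ, f θ ≠ j) :
    ∀ᶠ θ' in nhds θ, ⌊f θ'⌋ = ⌊f θ⌋ ∧ ∀ j : ℤ, f θ' ≠ j := by
  have h1 : (⌊f θ⌋ : ℝ) < f θ := lt_of_le_of_ne (Int.floor_le _) (h _).symm
  have h2 : f θ < ⌊f θ⌋ + 1 := Int.lt_floor_add_one _
  filter_upwards [hf.continuousAt.eventually (lt_mem_nhds h1),
    hf.continuousAt.eventually (gt_mem_nhds h2)] with θ' h3 h4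
  refine ⟨Int.floor_eq_iff.2 ⟨h3.le, h4⟩, fun j hj => ?_⟩
  rw [hj] at h3 h4
  have h5 : ⌊f θ⌋ < j := by exact_mod_cast h3
  have h6 : j < ⌊f θ⌋ + 1 := by exact_mod_cast h4
  omega

theorem isOpen_visit (c : ℕ) (a b : ℝ) (z : ℂ) : IsOpen (visit c a b z) := by
  rw [isOpen_iff_mem_nhds]
  rintro θ ⟨n, hn, hz, hab, hgen⟩
  have hfl : ∀ᶠ θ' : ℝ × ℝ in nhds θ, ∀ k ∈ range (n + 1),
      ⌊θ'.2 + k * θ'.1⌋ = ⌊θ.2 + k * θ.1⌋ ∧ ∀ j : ℤ, θ'.2 + k * θ'.1 ≠ j := by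
    rw [Filter.eventually_all_finset]
    intro k hk
    exact eventually_floor_eq (f := fun θ' : ℝ × ℝ => θ'.2 + k * θ'.1) (by fun_prop)
      (hgen k (by simpa [Nat.lt_succ_iff] using hk))
  have hcont : Continuous fun θ' : ℝ × ℝ => θ'.2 + n * θ'.1 - (⌊θ.2 + n * θ.1⌋ : ℝ) := by fun_prop
  have hfr : ∀ᶠ θ' : ℝ × ℝ in nhds θ,
      θ'.2 + n * θ'.1 - (⌊θ.2 + n * θ.1⌋ : ℝ) ∈ Set.Ioo a b :=
    hcont.continuousAt.eventually (isOpen_Ioo.mem_nhds hab)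
  filter_upwards [hfl, hfr] with θ' h1 h2
  have h3 : ∀ k ≤ n, height θ' k = height θ k := fun k hk => (h1 k (by simp; omega)).1
  refine ⟨n, hn, ?_, ?_, fun k hk => (h1 k (by simp; omega)).2⟩
  · rw [← hz]
    refine sum_congr rfl fun k hk => ?_
    have : k < n := by simpa using hk
    rw [h3 k (by omega), h3 (k + 1) (by omega)]
  · rw [Int.fract, (h1 n (by simp)).1]
    exact h2

theorem floor_add_half_div (a : ℤ) {q : ℕ} (hq : 0 < q) :
    ⌊((a : ℝ) + 1 / 2) / q⌋ = a / (q : ℤ) := by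
  have hq' : (0 : ℝ) < q := by exact_mod_cast hq
  have hqz : (0 : ℤ) < q := by exact_mod_cast hq
  have h1 := Int.mul_ediv_add_emod a q
  have h2 := Int.emod_nonneg a hqz.ne'
  have h3 := Int.emod_lt_of_pos a hqz
  have h4 : (q : ℤ) * (a / q) ≤ a := by omega
  have h5 : a + 1 ≤ (q : ℤ) * (a / q + 1) := by rw [mul_add]; omega
  have h4' : (q : ℝ) * ((a / (q : ℤ) : ℤ) : ℝ) ≤ a := by exact_mod_cast h4
  have h5' : (a : ℝ) + 1 ≤ q * (((a / (q : ℤ) : ℤ) : ℝ) + 1) := by exact_mod_cast h5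
  rw [Int.floor_eq_iff, le_div_iff₀ hq', div_lt_iff₀ hq']
  constructor <;> linarith

theorem add_half_div_ne (a j : ℤ) {q : ℕ} (hq : 0 < q) : ((a : ℝ) + 1 / 2) / q ≠ j := by
  have hq' : (q : ℝ) ≠ 0 := by exact_mod_cast hq.ne'
  intro h
  rw [div_eq_iff hq'] at h
  have h1 : ((2 * a + 1 : ℤ) : ℝ) = ((2 * (j * q) : ℤ) : ℝ) := by push_cast; linarith
  have h2 : 2 * a + 1 = 2 * (j * q) := by exact_mod_cast h1
  omega

theorem exists_int_near (x : ℝ) (c : ℤ) {q : ℕ} (hq : 0 < q) :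
    ∃ r : ℤ, r % 3 = c % 3 ∧ |(r : ℝ) / q - x| ≤ 3 / q := by
  have hq' : (0 : ℝ) < q := by exact_mod_cast hq
  refine ⟨3 * ⌊(q * x - c) / 3⌋ + c, by omega, ?_⟩
  have h1 := Int.floor_le ((q * x - c) / 3)
  have h2 := Int.lt_floor_add_one ((q * x - c) / 3)
  rw [show (((3 * ⌊(q * x - c) / 3⌋ + c : ℤ) : ℝ) / q - x) =
    (((3 * ⌊(q * x - c) / 3⌋ + c : ℤ) : ℝ) - q * x) / q by field_simp, abs_div, abs_of_pos hq']
  gcongr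
  push_cast
  rw [abs_le]
  constructor <;> linarith

theorem exists_int_half_near (x : ℝ) (c : ℤ) {q : ℕ} (hq : 0 < q) :
    ∃ r : ℤ, r % 3 = c % 3 ∧ |((r : ℝ) + 1 / 2) / q - x| ≤ 3 / q := by
  obtain ⟨r, hr, h⟩ := exists_int_near (x - 1 / 2 / q) c hq
  refine ⟨r, hr, ?_⟩
  rwa [add_div, show (r : ℝ) / q + 1 / 2 / q - x = r / q - (x - 1 / 2 / q) by ring]

theorem exists_pow_three_gt (C : ℝ) : ∃ m : ℕ, 0 < m ∧ C < ((3 * m : ℕ) : ℝ) ∧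
    ∀ p : ℤ, p % 3 = 1 → IsCoprime p ((3 * m : ℕ) : ℤ) := by
  obtain ⟨M, hM⟩ := pow_unbounded_of_one_lt C (by norm_num : (1 : ℝ) < 3)
  refine ⟨3 ^ M, by positivity, ?_, fun p hp => ?_⟩
  · have : (0 : ℝ) < 3 ^ M := by positivity
    push_cast
    linarith
  · have h3 : IsCoprime p 3 := ⟨1, -(p / 3), by omega⟩
    rw [show ((3 * 3 ^ M : ℕ) : ℤ) = 3 ^ (M + 1) by push_cast; ring]
    exact h3.pow_right

/-- The parameters of a rational trajectory of slope `p / q` away from the vertices. -/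
noncomputable def ratParam (p r : ℤ) (q : ℕ) : ℝ × ℝ := ((p : ℝ) / q, ((r : ℝ) + 1 / 2) / q)

theorem ratParam_apply (p r : ℤ) (q k : ℕ) :
    (ratParam p r q).2 + k * (ratParam p r q).1 = (((r + k * p : ℤ) : ℝ) + 1 / 2) / q := by
  simp only [ratParam]
  push_cast
  ring

theorem exists_ratParam_mem {U : Set (ℝ × ℝ)} (hU : IsOpen U) (hne : U.Nonempty) :
    ∃ C : ℝ, ∀ q : ℕ, C < q → ∀ c : ℤ, ∃ p r : ℤ, p % 3 = 1 ∧ r % 3 = c % 3 ∧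
      ratParam p r q ∈ U := by
  obtain ⟨θ, hθ⟩ := hne
  obtain ⟨δ, hδ, hball⟩ := Metric.isOpen_iff.1 hU θ hθ
  refine ⟨max (3 / δ) 0, fun q hq c => ?_⟩
  have hq0 : (0 : ℝ) < q := lt_of_le_of_lt (le_max_right _ _) hq
  have hq1 : 3 / (q : ℝ) < δ := by
    have := lt_of_le_of_lt (le_max_left _ _) hq
    rw [div_lt_iff₀ hδ] at this
    rw [div_lt_iff₀ hq0]
    linarith
  obtain ⟨p, hp, hp'⟩ := exists_int_near θ.1 1 (q := q) (by exact_mod_cast hq0)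
  obtain ⟨r, hr, hr'⟩ := exists_int_half_near θ.2 c (q := q) (by exact_mod_cast hq0)
  refine ⟨p, r, by simpa using hp, hr, hball ?_⟩
  rw [Metric.mem_ball, Prod.dist_eq, Real.dist_eq, Real.dist_eq]
  exact max_lt (hp'.trans_lt hq1) (hr'.trans_lt hq1)

theorem exists_visit {a b : ℝ} (ha : 0 ≤ a) (hab : a < b) (hb : b ≤ 1) {c : ℕ} (hc : c < 3)
    {U : Set (ℝ × ℝ)} (hU : IsOpen U) (hne : U.Nonempty) :
    ∃ z, IsEisenstein z ∧ (U ∩ visit c a b z).Nonempty := by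
  obtain ⟨C, hC⟩ := exists_ratParam_mem hU hne
  obtain ⟨m, hm, hCm, hcop⟩ := exists_pow_three_gt (max C (6 / (b - a)))
  set q : ℕ := 3 * m with hq
  obtain ⟨p, r, hp, hr, hmem⟩ := hC q ((le_max_left _ _).trans_lt hCm) 0
  have hq0 : 0 < q := by omega
  have hqr : (0 : ℝ) < q := by exact_mod_cast hq0
  have hlen : 3 / (q : ℝ) < (b - a) / 2 := by
    have h1 := (le_max_right _ _).trans_lt hCm
    rw [div_lt_iff₀ (by linarith)] at h1
    rw [div_lt_iff₀ hqr]
    linarith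
  obtain ⟨s, hs, hs'⟩ := exists_int_half_near ((a + b) / 2) c hq0
  have hs1 := abs_lt.1 (hs'.trans_lt hlen)
  obtain ⟨u, v, huv⟩ := hcop p hp
  set n : ℕ := ((u * (s - r)) % q).toNat with hn
  have hnz : (n : ℤ) = (u * (s - r)) % q := Int.toNat_of_nonneg (Int.emod_nonneg _ (by omega))
  obtain ⟨w, hw⟩ : (q : ℤ) ∣ r + n * p - s := by
    refine ⟨-(v * (s - r)) - (u * (s - r)) / q * p, ?_⟩
    have := Int.mul_ediv_add_emod (u * (s - r)) q
    rw [hnz]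
    linear_combination p * this + (s - r) * huv
  have hpos : (((r + n * p : ℤ) : ℝ) + 1 / 2) / q = ((s : ℝ) + 1 / 2) / q + w := by
    have : (r + n * p : ℤ) = s + q * w := by linarith
    rw [this]
    push_cast
    field_simp
    ring
  refine ⟨cocycle (ratParam p r q) n, isEisenstein_cocycle _ _, ratParam p r q, hmem, n, ?_, rfl,
    ?_, fun k _ j => ?_⟩
  · have h1 : (n * p : ℤ) % 3 = (n : ℤ) % 3 := by rw [Int.mul_emod, hp]; simp
    have h2 : (r + n * p - s) % 3 = 0 := by
      rw [hw, hq]; push_cast; rw [mul_assoc]; exact Int.mul_emod_right _ _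
    omega
  · rw [ratParam_apply, hpos, Int.fract_add_intCast, Int.fract_eq_self.2]
    · constructor <;> linarith [hs1.1, hs1.2]
    · constructor <;> linarith [hs1.1, hs1.2]
  · rw [ratParam_apply]
    exact add_half_div_ne _ _ hq0

theorem visit_add_omega_pow {a b : ℝ} {c : ℕ} {z : ℂ} {U : Set (ℝ × ℝ)} (hU : IsOpen U)
    (hne : (U ∩ visit c a b z).Nonempty) (i : ℕ) :
    (U ∩ visit c a b (z + omega ^ i)).Nonempty := by
  obtain ⟨C, hC⟩ := exists_ratParam_mem (hU.inter (isOpen_visit c a b z)) hne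
  obtain ⟨m, hm, hCm, hcop⟩ := exists_pow_three_gt C
  obtain ⟨p, r, hp, hr, hmemU, n, hn, hz, hfr, -⟩ := hC (3 * m) hCm (-i)
  have hsum := fun e => sum_omega_pow_mul_div hm hp (hcop p hp) (r + n * p) e
  have hs0 := sum_omega_pow m
  set q : ℕ := 3 * m with hq
  have hq0 : 0 < q := by omega
  have hheight : ∀ k, height (ratParam p r q) k = (r + k * p) / (q : ℤ) := by
    intro k
    rw [height, ratParam_apply, floor_add_half_div _ hq0]
  refine ⟨ratParam p r q, hmemU, n + q, by omega, ?_, ?_, fun k _ j => ?_⟩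
  · have h3 : (n * p : ℤ) % 3 = (n : ℤ) % 3 := by rw [Int.mul_emod, hp]; simp
    have h4 := hsum (i + 2 * n + 2) (by push_cast; omega)
    have h5 : omega ^ i = omega ^ (n + 1 + (i + 2 * n + 2)) := omega_pow_eq (by omega)
    rw [← hz, cocycle, sum_range_add, ← cocycle, h5, pow_add omega (n + 1), ← h4]
    congr 1
    have h6 : ∀ k, omega ^ (n + k) * (1 + omega * ((height (ratParam p r q) (n + k + 1) -
        height (ratParam p r q) (n + k) : ℤ) : ℂ)) = omega ^ n * omega ^ k + omega ^ (n + 1) *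
        (omega ^ k * (((r + n * p + (k + 1 : ℕ) * p) / (q : ℤ) -
          (r + n * p + k * p) / (q : ℤ) : ℤ) : ℂ)) := by
      intro k
      rw [hheight, hheight, show r + ((n + k + 1 : ℕ) : ℤ) * p = r + n * p + (k + 1 : ℕ) * p by
        push_cast; ring, show r + ((n + k : ℕ) : ℤ) * p = r + n * p + k * p by push_cast; ring]
      ring
    rw [sum_congr rfl fun k _ => h6 k, sum_add_distrib, ← mul_sum, ← mul_sum, hs0]
    ring
  · have hq' : (q : ℝ) ≠ 0 := by exact_mod_cast hq0.ne'
    have : (ratParam p r q).2 + ((n + q : ℕ) : ℝ) * (ratParam p r q).1 =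
        (ratParam p r q).2 + n * (ratParam p r q).1 + (p : ℤ) := by
      simp only [ratParam]
      push_cast
      field_simp
      ring
    rw [this, Int.fract_add_intCast]
    exact hfr
  · rw [ratParam_apply]
    exact add_half_div_ne _ _ hq0

theorem visit_add_nat_mul {a b : ℝ} {c : ℕ} {z : ℂ} {U : Set (ℝ × ℝ)} (hU : IsOpen U)
    (hne : (U ∩ visit c a b z).Nonempty) (i N : ℕ) :
    (U ∩ visit c a b (z + N * omega ^ i)).Nonempty := by
  induction N with
  | zero => simpa using hne
  | succ N ih =>
    have := visit_add_omega_pow hU ih i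
    rwa [show z + ((N + 1 : ℕ) : ℂ) * omega ^ i = z + N * omega ^ i + omega ^ i by
      push_cast; ring]

theorem dense_visit {a b : ℝ} (ha : 0 ≤ a) (hab : a < b) (hb : b ≤ 1) {c : ℕ} (hc : c < 3)
    {z : ℂ} (hz : IsEisenstein z) : Dense (visit c a b z) := by
  rw [dense_iff_inter_open]
  intro U hU hne
  obtain ⟨z₀, hz₀, h⟩ := exists_visit ha hab hb hc hU hne
  obtain ⟨A, B, D, rfl⟩ := hz₀.exists_nat_combination hz
  have h1 := visit_add_nat_mul hU (visit_add_nat_mul hU (visit_add_nat_mul hU h 0 A) 1 B) 2 D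
  simpa using h1

/-- Almost every parameter, in the sense of Baire, gives a trajectory that visits everything. -/
theorem exists_transitive_param : ∃ α t : ℝ, 0 < α ∧ α < 1 ∧ (∀ k j : ℤ, t + k * α ≠ j) ∧
    ∀ c < 3, ∀ z, IsEisenstein z → ∀ a b : ℝ, 0 ≤ a → a < b → b ≤ 1 →
      ∃ n : ℕ, n % 3 = c ∧ cocycle (α, t) n = z ∧ Int.fract (t + n * α) ∈ Set.Ioo a b := by
  let I := {x : Fin 3 × (ℤ × ℤ) × (ℚ × ℚ) // 0 ≤ x.2.2.1 ∧ x.2.2.1 < x.2.2.2 ∧ x.2.2.2 ≤ 1}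
  have hV : Dense (⋂ x : I, visit x.1.1 (x.1.2.2.1 : ℝ) (x.1.2.2.2 : ℝ)
      (x.1.2.1.1 + x.1.2.1.2 * omega)) := by
    refine dense_iInter_of_isOpen (fun x => isOpen_visit _ _ _ _) fun x => ?_
    refine dense_visit (by exact_mod_cast x.2.1) (by exact_mod_cast x.2.2.1)
      (by exact_mod_cast x.2.2.2) x.1.1.2 ⟨_, _, rfl⟩
  let W : ℤ × ℤ → Set (ℝ × ℝ) := fun x => {θ | θ.2 + x.1 * θ.1 ≠ x.2}
  have hWo : ∀ x, IsOpen (W x) := fun x =>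
    isOpen_ne_fun (by fun_prop) (by fun_prop)
  have hWd : ∀ x, Dense (W x) := by
    intro x
    rw [dense_iff_inter_open]
    rintro U hU ⟨θ, hθ⟩
    have hc : Continuous fun s : ℝ => (θ.1, s) := by fun_prop
    have hd : Dense ({(x.2 : ℝ) - x.1 * θ.1}ᶜ : Set ℝ) := dense_compl_singleton _
    obtain ⟨s, hs, hs'⟩ := hd.inter_open_nonempty _ (hU.preimage hc) ⟨θ.2, hθ⟩
    refine ⟨(θ.1, s), hs, fun h => hs' ?_⟩
    simp only at h
    rw [Set.mem_singleton_iff]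
    linarith
  have hall : Dense (⋂ x : I ⊕ (ℤ × ℤ), Sum.elim (fun x : I => visit x.1.1 (x.1.2.2.1 : ℝ)
      (x.1.2.2.2 : ℝ) (x.1.2.1.1 + x.1.2.1.2 * omega)) W x) := by
    refine dense_iInter_of_isOpen ?_ ?_
    · rintro (x | x)
      exacts [isOpen_visit _ _ _ _, hWo x]
    · rintro (x | x)
      · exact hV.mono (Set.iInter_subset _ x)
      · exact hWd x
  obtain ⟨⟨α, t⟩, ⟨hα, -⟩, h⟩ := hall.inter_open_nonempty
    (Set.Ioo (0 : ℝ) 1 ×ˢ Set.univ) (isOpen_Ioo.prod isOpen_univ) ⟨(1 / 2, 0), by norm_num⟩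
  rw [Set.mem_iInter] at h
  refine ⟨α, t, hα.1, hα.2, fun k j => h (Sum.inr (k, j)), ?_⟩
  rintro c hc z ⟨i, j, rfl⟩ a b ha hab hb
  obtain ⟨a', ha', ha''⟩ := exists_rat_btwn hab
  obtain ⟨b', hb', hb''⟩ := exists_rat_btwn ha''
  obtain ⟨n, h1, h2, h3, -⟩ := h (Sum.inl ⟨(⟨c, hc⟩, (i, j), (a', b')), by
    refine ⟨?_, ?_, ?_⟩
    · exact_mod_cast (ha.trans ha'.le)
    · exact_mod_cast hb'
    · exact_mod_cast (hb''.le.trans hb)⟩)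
  exact ⟨n, h1, h2, ha'.trans h3.1, h3.2.trans hb''⟩

/-- The first coordinate with respect to the basis `1, ζ` of the plane. -/
noncomputable def cx : ℂ →ₗ[ℝ] ℝ := Complex.reLm - (Real.sqrt 3)⁻¹ • Complex.imLm

/-- The second coordinate with respect to the basis `1, ζ` of the plane. -/
noncomputable def cy : ℂ →ₗ[ℝ] ℝ := (2 * (Real.sqrt 3)⁻¹) • Complex.imLm

/-- The point with given coordinates with respect to the basis `1, ζ` of the plane. -/
noncomputable def pt (x y : ℝ) : ℂ := x + y * zeta

theorem sqrt_three_inv_mul : (Real.sqrt 3)⁻¹ * Real.sqrt 3 = 1 :=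
  inv_mul_cancel₀ (by positivity)

@[simp] theorem cx_pt (x y : ℝ) : cx (pt x y) = x := by
  simp [cx, pt, zeta]
  linear_combination (-(y / 2)) * sqrt_three_inv_mul

@[simp] theorem cy_pt (x y : ℝ) : cy (pt x y) = y := by
  simp [cy, pt, zeta]
  linear_combination y * sqrt_three_inv_mul

theorem pt_coords (z : ℂ) : pt (cx z) (cy z) = z := by
  apply Complex.ext
  · simp [cx, cy, pt, zeta]
    ring
  · simp [cx, cy, pt, zeta]
    field_simp
    rw [Real.sq_sqrt (by norm_num)]

theorem ext_coords {z w : ℂ} (hx : cx z = cx w) (hy : cy z = cy w) : z = w := by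
  rw [← pt_coords z, ← pt_coords w, hx, hy]

@[simp] theorem cx_zeta : cx zeta = 0 := by
  rw [show zeta = pt 0 1 by simp [pt], cx_pt]

@[simp] theorem cy_zeta : cy zeta = 1 := by
  rw [show zeta = pt 0 1 by simp [pt], cy_pt]

theorem omega_mul_pt (x y : ℝ) : omega * pt x y = pt (-x - y) x := by
  have h := zeta_sq
  simp only [pt, omega]
  push_cast
  linear_combination (x + y * zeta + y : ℂ) * h

@[simp] theorem cx_omega_mul (z : ℂ) : cx (omega * z) = -cx z - cy z := by
  conv_lhs => rw [← pt_coords z, omega_mul_pt, cx_pt]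

@[simp] theorem cy_omega_mul (z : ℂ) : cy (omega * z) = cx z := by
  conv_lhs => rw [← pt_coords z, omega_mul_pt, cy_pt]

theorem cx_real_mul (r : ℝ) (z : ℂ) : cx (r * z) = r * cx z := by
  rw [← Complex.real_smul, map_smul, smul_eq_mul]

theorem cy_real_mul (r : ℝ) (z : ℂ) : cy (r * z) = r * cy z := by
  rw [← Complex.real_smul, map_smul, smul_eq_mul]

theorem conj_zeta : (starRingEnd ℂ) zeta = 1 - zeta := by
  apply Complex.ext
  · simp [zeta]; norm_num
  · simp [zeta]

theorem conj_pt (x y : ℝ) : (starRingEnd ℂ) (pt x y) = pt (x + y) (-y) := by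
  simp only [pt, map_add, map_mul, Complex.conj_ofReal, conj_zeta]
  push_cast
  ring

/-- An odd integer, as a real number. -/
def IsOdd (r : ℝ) : Prop := ∃ k : ℤ, r = 2 * k + 1

/-- A real number that is not an integer. -/
def NotInt (r : ℝ) : Prop := ∀ k : ℤ, r ≠ k

theorem IsOdd.not_notInt {r : ℝ} (h : IsOdd r) : ¬ NotInt r := by
  obtain ⟨k, rfl⟩ := h
  exact fun h => h (2 * k + 1) (by push_cast; ring)

theorem IsOdd.neg {r : ℝ} (h : IsOdd r) : IsOdd (-r) := by
  obtain ⟨k, rfl⟩ := h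
  exact ⟨-k - 1, by push_cast; ring⟩

theorem IsOdd.add_two_mul {r : ℝ} (h : IsOdd r) (j : ℤ) : IsOdd (r + 2 * j) := by
  obtain ⟨k, rfl⟩ := h
  exact ⟨k + j, by push_cast; ring⟩

theorem NotInt.add_int {r : ℝ} (h : NotInt r) (j : ℤ) : NotInt (r + j) := by
  intro k hk
  exact h (k - j) (by push_cast; linarith)

theorem NotInt.int_sub {r : ℝ} (h : NotInt r) (j : ℤ) : NotInt (j - r) := by
  intro k hk
  exact h (j - k) (by push_cast; linarith)

theorem not_isOdd_of_mem {r : ℝ} (h : -1 < r ∧ r < 1) : ¬ IsOdd r := by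
  rintro ⟨k, rfl⟩
  have h1 : (0 : ℝ) < ((k + 1 : ℤ) : ℝ) := by push_cast; linarith
  have h2 : ((k : ℤ) : ℝ) < 0 := by linarith
  have h3 : 0 < k + 1 := by exact_mod_cast h1
  have h4 : k < 0 := by exact_mod_cast h2
  omega

theorem not_isOdd_of_mem' {r : ℝ} (h : 1 < r ∧ r < 3) : ¬ IsOdd r := by
  intro h'
  refine not_isOdd_of_mem ⟨?_, ?_⟩ (h'.add_two_mul (-1))
  · push_cast; linarith
  · push_cast; linarith

theorem notInt_of_mem {r : ℝ} (j : ℤ) (h : (j : ℝ) < r ∧ r < j + 1) : NotInt r := by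
  rintro k rfl
  have h1 : j < k := by exact_mod_cast h.1
  have h2 : k < j + 1 := by exact_mod_cast h.2
  omega

/-- The union of the lines that contain the edges. -/
def lines : Set ℂ := {z | IsOdd (cx z) ∨ IsOdd (cy z) ∨ IsOdd (cx z + cy z)}

/-- The interior points of the edges of direction `ζ`. -/
def edgesX : Set ℂ := {z | IsOdd (cx z) ∧ NotInt (cy z)}

/-- The interior points of the edges of direction `1`. -/
def edgesY : Set ℂ := {z | IsOdd (cy z) ∧ NotInt (cx z)}

/-- The interior points of the edges of direction `ζ²`. -/
def edgesW : Set ℂ := {z | IsOdd (cx z + cy z) ∧ NotInt (cx z)}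

/-- Refraction at an edge of direction `ζ`. -/
noncomputable def refX (v : ℂ) : ℂ := pt (cx v) (-cx v - cy v)

/-- Refraction at an edge of direction `1`. -/
noncomputable def refY (v : ℂ) : ℂ := pt (-cx v - cy v) (cy v)

/-- Refraction at an edge of direction `ζ²`. -/
noncomputable def refW (v : ℂ) : ℂ := pt (cy v) (cx v)

theorem omega_mul_mem_lines {z : ℂ} (h : omega * z ∈ lines) : z ∈ lines := by
  simp only [lines, Set.mem_ofPred_eq, cx_omega_mul, cy_omega_mul] at h ⊢
  rcases h with h | h | h
  · exact Or.inr (Or.inr (by simpa [add_comm] using h.neg))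
  · exact Or.inl h
  · exact Or.inr (Or.inl (by simpa using h.neg))

theorem omega_mul_mem_edgesY {z : ℂ} (h : z ∈ edgesX) : omega * z ∈ edgesY := by
  obtain ⟨⟨k, hk⟩, h2⟩ := h
  refine ⟨⟨k, by simpa using hk⟩, ?_⟩
  rw [cx_omega_mul, hk]
  simpa using h2.int_sub (-(2 * k + 1))

theorem omega_mul_mem_edgesW {z : ℂ} (h : z ∈ edgesY) : omega * z ∈ edgesW := by
  obtain ⟨⟨k, hk⟩, h2⟩ := h
  refine ⟨?_, ?_⟩
  · rw [cx_omega_mul, cy_omega_mul]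
    convert IsOdd.neg ⟨k, hk⟩ using 1
    ring
  rw [cx_omega_mul, hk]
  have := h2.int_sub (-(2 * k + 1))
  push_cast at this
  convert this using 1
  ring

theorem omega_mul_mem_edgesX {z : ℂ} (h : z ∈ edgesW) : omega * z ∈ edgesX := by
  obtain ⟨h1, h2⟩ := h
  refine ⟨?_, by simpa using h2⟩
  rw [cx_omega_mul]
  convert h1.neg using 1
  ring

theorem omega_mul_refX (v : ℂ) : omega * refX v = refY (omega * v) := by
  rw [refX, refY, omega_mul_pt, cx_omega_mul, cy_omega_mul]
  congr 1; ring

theorem omega_mul_refY (v : ℂ) : omega * refY v = refW (omega * v) := by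
  rw [refY, refW, omega_mul_pt, cx_omega_mul, cy_omega_mul]
  congr 1; ring

theorem omega_mul_refW (v : ℂ) : omega * refW v = refX (omega * v) := by
  rw [refW, refX, omega_mul_pt, cx_omega_mul, cy_omega_mul]
  congr 1 <;> ring

/-- The path from `A` over `B` to `C` is refracted at `B`, an interior point of an edge. -/
def Refracts (A B C : ℂ) : Prop :=
  (B ∈ edgesX ∧ SameRay ℝ (refX (B - A)) (C - B)) ∨
  (B ∈ edgesY ∧ SameRay ℝ (refY (B - A)) (C - B)) ∨
  (B ∈ edgesW ∧ SameRay ℝ (refW (B - A)) (C - B))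

theorem _root_.SameRay.complex_mul {v w : ℂ} (h : SameRay ℝ v w) (c : ℂ) :
    SameRay ℝ (c * v) (c * w) := h.map (LinearMap.mulLeft ℝ c)

theorem Refracts.omega_mul {A B C : ℂ} (h : Refracts A B C) :
    Refracts (omega * A) (omega * B) (omega * C) := by
  simp only [Refracts, ← mul_sub]
  rcases h with ⟨h1, h2⟩ | ⟨h1, h2⟩ | ⟨h1, h2⟩
  · exact Or.inr (Or.inl ⟨omega_mul_mem_edgesY h1, omega_mul_refX _ ▸ h2.complex_mul omega⟩)
  · exact Or.inr (Or.inr ⟨omega_mul_mem_edgesW h1, omega_mul_refY _ ▸ h2.complex_mul omega⟩)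
  · exact Or.inl ⟨omega_mul_mem_edgesX h1, omega_mul_refW _ ▸ h2.complex_mul omega⟩

theorem IsEisenstein.exists_coords {x : ℂ} (hx : IsEisenstein x) :
    ∃ i j : ℤ, cx (2 * x) = 2 * i ∧ cy (2 * x) = 2 * j := by
  obtain ⟨i, j, rfl⟩ := hx
  have h : (2 * ((i : ℂ) + j * omega)) = pt (2 * (i - j)) (2 * j) := by
    rw [pt, zeta_eq]; push_cast; ring
  exact ⟨i - j, j, by rw [h, cx_pt]; push_cast; ring, by rw [h, cy_pt]⟩

theorem add_mem_lines {z x : ℂ} (hx : IsEisenstein x) (h : z + 2 * x ∈ lines) : z ∈ lines := by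
  obtain ⟨i, j, hi, hj⟩ := hx.exists_coords
  simp only [lines, Set.mem_ofPred_eq, map_add, hi, hj] at h ⊢
  rcases h with h | h | h
  · exact Or.inl (by simpa using h.add_two_mul (-i))
  · exact Or.inr (Or.inl (by simpa using h.add_two_mul (-j)))
  · refine Or.inr (Or.inr ?_)
    convert h.add_two_mul (-i - j) using 1
    push_cast; ring

theorem Refracts.add {A B C x : ℂ} (hx : IsEisenstein x) (h : Refracts A B C) :
    Refracts (A + 2 * x) (B + 2 * x) (C + 2 * x) := by
  obtain ⟨i, j, hi, hj⟩ := hx.exists_coords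
  simp only [Refracts, add_sub_add_right_eq_sub, edgesX, edgesY, edgesW, Set.mem_ofPred_eq,
    map_add, hi, hj] at h ⊢
  rcases h with ⟨⟨h1, h2⟩, h3⟩ | ⟨⟨h1, h2⟩, h3⟩ | ⟨⟨h1, h2⟩, h3⟩
  · exact Or.inl ⟨⟨h1.add_two_mul i, by simpa using h2.add_int (2 * j)⟩, h3⟩
  · exact Or.inr (Or.inl ⟨⟨h1.add_two_mul j, by simpa using h2.add_int (2 * i)⟩, h3⟩)
  · refine Or.inr (Or.inr ⟨⟨?_, by simpa using h2.add_int (2 * i)⟩, h3⟩)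
    convert h1.add_two_mul (i + j) using 1
    push_cast; ring

/-- The rigid motion that is a rotation by `120 n` degrees followed by a translation by `2 x`. -/
noncomputable def motion (n : ℕ) (x z : ℂ) : ℂ := omega ^ n * z + 2 * x

theorem Refracts.motion {A B C x : ℂ} (hx : IsEisenstein x) (h : Refracts A B C) (n : ℕ) :
    Refracts (motion n x A) (motion n x B) (motion n x C) := by
  refine Refracts.add hx ?_
  induction n with
  | zero => simpa using h
  | succ n ih => simpa only [pow_succ', mul_assoc] using ih.omega_mul

theorem motion_mem_lines {x z : ℂ} (hx : IsEisenstein x) {n : ℕ} (h : motion n x z ∈ lines) :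
    z ∈ lines := by
  have h' := add_mem_lines hx h
  clear h
  induction n with
  | zero => simpa using h'
  | succ n ih => exact ih (omega_mul_mem_lines (by simpa only [pow_succ', mul_assoc] using h'))

theorem zeta_pow_three : zeta ^ 3 = -1 := by
  linear_combination (zeta + 1) * zeta_sq

theorem vertex_coords (a b : ℤ) : vertex a b 0 = pt (2 * a + 1) (2 * b) ∧
    vertex a b 1 = pt (2 * a) (2 * b + 1) ∧ vertex a b 2 = pt (2 * a - 1) (2 * b + 1) ∧
    vertex a b 3 = pt (2 * a - 1) (2 * b) ∧ vertex a b 4 = pt (2 * a) (2 * b - 1) ∧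
    vertex a b 5 = pt (2 * a + 1) (2 * b - 1) ∧ vertex a b 6 = pt (2 * a + 1) (2 * b) := by
  have h2 := zeta_sq
  have h3 := zeta_pow_three
  simp only [vertex, pt]
  push_cast
  refine ⟨by ring, by ring, ?_, ?_, ?_, ?_, ?_⟩
  · linear_combination h2
  · linear_combination h3
  · linear_combination zeta * h3
  · linear_combination zeta ^ 2 * h3 - h2
  · linear_combination (zeta ^ 3 - 1) * h3

theorem edge_coords (a b : ℤ) (k : Fin 6) :
    (edgeStart (a, b, k), edgeEnd (a, b, k)) =
    ![(pt (2 * a + 1) (2 * b), pt (2 * a) (2 * b + 1)),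
      (pt (2 * a) (2 * b + 1), pt (2 * a - 1) (2 * b + 1)),
      (pt (2 * a - 1) (2 * b + 1), pt (2 * a - 1) (2 * b)),
      (pt (2 * a - 1) (2 * b), pt (2 * a) (2 * b - 1)),
      (pt (2 * a) (2 * b - 1), pt (2 * a + 1) (2 * b - 1)),
      (pt (2 * a + 1) (2 * b - 1), pt (2 * a + 1) (2 * b))] k := by
  obtain ⟨h0, h1, h2, h3, h4, h5, h6⟩ := vertex_coords a b
  fin_cases k <;> simp [edgeStart, edgeEnd, h0, h1, h2, h3, h4, h5, h6]

theorem reflection_span_singleton {d : ℂ} (hd : d.re ^ 2 + d.im ^ 2 = 1) (v : ℂ) :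
    (Submodule.span ℝ {d}).reflection v = d ^ 2 * (starRingEnd ℂ) v := by
  have hn : ‖d‖ ^ 2 = 1 := by rw [← Complex.normSq_eq_norm_sq, Complex.normSq_apply]; linarith
  rw [Submodule.reflection_singleton_apply]
  simp only [RCLike.ofReal_real_eq_id, id_eq, hn, div_one]
  apply Complex.ext
  · simp [Complex.inner, pow_two]
    linear_combination v.re * hd
  · simp [Complex.inner, pow_two]
    linear_combination v.im * hd

theorem edge_direction (a b : ℤ) (k : Fin 6) :
    edgeEnd (a, b, k) - edgeStart (a, b, k) = zeta ^ ((k : ℕ) + 2) := by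
  simp only [edgeEnd, edgeStart, vertex]
  linear_combination (-zeta ^ (k : ℕ)) * zeta_sq

theorem normSq_zeta_pow (k : ℕ) : (zeta ^ k).re ^ 2 + (zeta ^ k).im ^ 2 = 1 := by
  have h : Real.sqrt 3 * Real.sqrt 3 = 3 := Real.mul_self_sqrt (by norm_num)
  have h1 : Complex.normSq zeta = 1 := by
    rw [Complex.normSq_apply]; simp only [zeta]; linarith
  have h2 : Complex.normSq (zeta ^ k) = 1 := by rw [map_pow, h1, one_pow]
  rw [Complex.normSq_apply] at h2
  linarith

theorem refract_eq (a b : ℤ) (k : Fin 6) (v : ℂ) :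
    refract (a, b, k) v = -(omega ^ ((k : ℕ) + 2) * (starRingEnd ℂ) v) := by
  have h : (edgeEnd (a, b, k) - edgeStart (a, b, k)) = zeta ^ ((k : ℕ) + 2) := edge_direction a b k
  rw [refract, reflection_span_singleton (by rw [h]; exact normSq_zeta_pow _), h, omega, ← pow_mul,
    ← pow_mul, mul_comm 2]

theorem omega_pow_mul_pt (k : ℕ) (x y : ℝ) : omega ^ (3 * k) * pt x y = pt x y ∧
    omega ^ (3 * k + 1) * pt x y = pt (-x - y) x ∧
    omega ^ (3 * k + 2) * pt x y = pt y (-x - y) := by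
  have h : omega ^ (3 * k) = 1 := by rw [pow_mul, omega_cube, one_pow]
  refine ⟨by rw [h, one_mul], by rw [pow_succ, h, one_mul, omega_mul_pt], ?_⟩
  rw [pow_succ, pow_succ, h, one_mul, mul_assoc, omega_mul_pt, omega_mul_pt]
  congr 1; ring

theorem neg_pt (x y : ℝ) : -pt x y = pt (-x) (-y) := by
  simp only [pt]; push_cast; ring

theorem refract_cases (a b : ℤ) (k : Fin 6) (v : ℂ) :
    refract (a, b, k) v = ![refW v, refY v, refX v, refW v, refY v, refX v] k := by
  rw [refract_eq]
  conv_lhs => rw [← pt_coords v, conj_pt]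
  obtain ⟨h3, h4, h5⟩ := omega_pow_mul_pt 1 (cx v + cy v) (-cy v)
  obtain ⟨h6, h7, -⟩ := omega_pow_mul_pt 2 (cx v + cy v) (-cy v)
  obtain ⟨-, -, h2⟩ := omega_pow_mul_pt 0 (cx v + cy v) (-cy v)
  norm_num at h2 h3 h4 h5 h6 h7
  fin_cases k <;> simp [h2, h3, h4, h5, h6, h7, neg_pt, refX, refY, refW] <;> congr 1 <;> ring

theorem mem_openSegment_pt {x₁ y₁ x₂ y₂ : ℝ} {z : ℂ}
    (h : z ∈ openSegment ℝ (pt x₁ y₁) (pt x₂ y₂)) :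
    ∃ s t : ℝ, 0 < s ∧ 0 < t ∧ s + t = 1 ∧ cx z = s * x₁ + t * x₂ ∧ cy z = s * y₁ + t * y₂ := by
  obtain ⟨s, t, hs, ht, hst, rfl⟩ := h
  exact ⟨s, t, hs, ht, hst, by simp [cx_real_mul], by simp [cy_real_mul]⟩

theorem openSegment_edge_subset (a b : ℤ) (k : Fin 6) :
    openSegment ℝ (edgeStart (a, b, k)) (edgeEnd (a, b, k)) ⊆
      ![edgesW, edgesY, edgesX, edgesW, edgesY, edgesX] k := by
  have he := edge_coords a b k
  intro z hz
  have hW : ∀ s t : ℝ, 0 < s → 0 < t → s + t = 1 → ∀ i : ℤ, NotInt (i + t) :=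
    fun s t hs ht hst i => notInt_of_mem i ⟨by linarith, by linarith⟩
  fin_cases k <;> simp only [Fin.reduceFinMk, Fin.isValue, Fin.zero_eta, Fin.mk_one,
    Matrix.cons_val, Prod.mk.injEq] at he hz ⊢ <;> rw [he.1, he.2] at hz <;>
    obtain ⟨s, t, hs, ht, hst, h1, h2⟩ := mem_openSegment_pt hz
  · refine ⟨⟨a + b, ?_⟩, ?_⟩
    · rw [h1, h2]; push_cast; linear_combination (2 * a + 2 * b + 1 : ℝ) * hst
    · have := hW t s ht hs (by linarith) (2 * a)
      rw [h1]; convert this using 1; push_cast; linear_combination (2 * a : ℝ) * hst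
  · refine ⟨⟨b, ?_⟩, ?_⟩
    · rw [h2]; linear_combination (2 * b + 1 : ℝ) * hst
    · have := hW t s ht hs (by linarith) (2 * a - 1)
      rw [h1]; convert this using 1; push_cast; linear_combination (2 * a - 1 : ℝ) * hst
  · refine ⟨⟨a - 1, ?_⟩, ?_⟩
    · rw [h1]; push_cast; linear_combination (2 * a - 1 : ℝ) * hst
    · have := hW t s ht hs (by linarith) (2 * b)
      rw [h2]; convert this using 1; push_cast; linear_combination (2 * b : ℝ) * hst
  · refine ⟨⟨a + b - 1, ?_⟩, ?_⟩
    · rw [h1, h2]; push_cast; linear_combination (2 * a + 2 * b - 1 : ℝ) * hst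
    · have := hW s t hs ht hst (2 * a - 1)
      rw [h1]; convert this using 1; push_cast; linear_combination (2 * a - 1 : ℝ) * hst
  · refine ⟨⟨b - 1, ?_⟩, ?_⟩
    · rw [h2]; push_cast; linear_combination (2 * b - 1 : ℝ) * hst
    · have := hW s t hs ht hst (2 * a)
      rw [h1]; convert this using 1; push_cast; linear_combination (2 * a : ℝ) * hst
  · refine ⟨⟨a, ?_⟩, ?_⟩
    · rw [h1]; linear_combination (2 * a + 1 : ℝ) * hst
    · have := hW s t hs ht hst (2 * b - 1)
      rw [h2]; convert this using 1; push_cast; linear_combination (2 * b - 1 : ℝ) * hst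

theorem mem_lines_of_mem_segment {A B z : ℂ} (hz : z ∈ segment ℝ A B)
    (h : (cx A = cx B ∧ IsOdd (cx A)) ∨ (cy A = cy B ∧ IsOdd (cy A)) ∨
      (cx A + cy A = cx B + cy B ∧ IsOdd (cx A + cy A))) : z ∈ lines := by
  obtain ⟨s, t, hs, ht, hst, rfl⟩ := hz
  simp only [lines, Set.mem_ofPred_eq, map_add, map_smul, smul_eq_mul]
  rcases h with ⟨h1, h2⟩ | ⟨h1, h2⟩ | ⟨h1, h2⟩
  · left
    convert h2 using 1
    linear_combination cx A * hst - t * h1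
  · right; left
    convert h2 using 1
    linear_combination cy A * hst - t * h1
  · right; right
    convert h2 using 1
    linear_combination (cx A + cy A) * hst - t * h1

theorem skeleton_subset_lines : skeleton ⊆ lines := by
  intro z hz
  obtain ⟨⟨a, b, k⟩, hz⟩ := Set.mem_iUnion.1 hz
  have he := edge_coords a b k
  refine mem_lines_of_mem_segment hz ?_
  have e1 : ∀ a : ℤ, IsOdd (2 * (a : ℝ) + 1) := fun a => ⟨a, rfl⟩
  have e2 : ∀ a : ℤ, IsOdd (2 * (a : ℝ) - 1) := fun a => ⟨a - 1, by push_cast; ring⟩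
  fin_cases k <;> simp only [Fin.reduceFinMk, Fin.isValue, Fin.zero_eta, Fin.mk_one,
    Matrix.cons_val, Prod.mk.injEq] at he ⊢ <;> rw [he.1, he.2] <;> simp only [cx_pt, cy_pt]
  · exact Or.inr (Or.inr ⟨by ring, a + b, by push_cast; ring⟩)
  · exact Or.inr (Or.inl ⟨trivial, e1 b⟩)
  · exact Or.inl ⟨trivial, e2 a⟩
  · exact Or.inr (Or.inr ⟨by ring, a + b - 1, by push_cast; ring⟩)
  · exact Or.inr (Or.inl ⟨trivial, e2 b⟩)
  · exact Or.inl ⟨trivial, e1 a⟩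

theorem mem_openSegment_pt_of_coords {x₁ y₁ x₂ y₂ : ℝ} {z : ℂ} (t : ℝ) (h0 : 0 < t) (h1 : t < 1)
    (hx : cx z = (1 - t) * x₁ + t * x₂) (hy : cy z = (1 - t) * y₁ + t * y₂) :
    z ∈ openSegment ℝ (pt x₁ y₁) (pt x₂ y₂) :=
  ⟨1 - t, t, by linarith, h0, by ring, ext_coords
    (by rw [map_add, map_smul, map_smul, cx_pt, cx_pt, hx, smul_eq_mul, smul_eq_mul])
    (by rw [map_add, map_smul, map_smul, cy_pt, cy_pt, hy, smul_eq_mul, smul_eq_mul])⟩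

theorem NotInt.exists_fract {r : ℝ} (h : NotInt r) :
    ∃ (k : ℤ) (s : ℝ), 0 < s ∧ s < 1 ∧ (r = 2 * k + s ∨ r = 2 * k - 1 + s) := by
  have h1 : 0 < Int.fract r := lt_of_le_of_ne (Int.fract_nonneg r) fun h' => h ⌊r⌋ (by
    have := Int.self_sub_floor r
    linarith)
  have h3 := Int.floor_add_fract r
  obtain ⟨k, hk | hk⟩ : ∃ k : ℤ, ⌊r⌋ = 2 * k ∨ ⌊r⌋ = 2 * k - 1 :=
    ⟨(⌊r⌋ + 1) / 2, by omega⟩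
  · refine ⟨k, Int.fract r, h1, Int.fract_lt_one r, Or.inl ?_⟩
    rw [hk] at h3; push_cast at h3; exact h3.symm
  · refine ⟨k, Int.fract r, h1, Int.fract_lt_one r, Or.inr ?_⟩
    rw [hk] at h3; push_cast at h3; exact h3.symm

theorem exists_edge {z : ℂ} (h : z ∈ edgesX ∨ z ∈ edgesY ∨ z ∈ edgesW) :
    ∃ e, z ∈ openSegment ℝ (edgeStart e) (edgeEnd e) := by
  have key : ∀ a b k, z ∈ openSegment ℝ (edgeStart (a, b, k), edgeEnd (a, b, k)).1
      (edgeStart (a, b, k), edgeEnd (a, b, k)).2 →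
      ∃ e, z ∈ openSegment ℝ (edgeStart e) (edgeEnd e) := fun a b k h => ⟨_, h⟩
  rcases h with ⟨⟨k, h1⟩, h2⟩ | ⟨⟨k, h1⟩, h2⟩ | ⟨⟨k, h1⟩, h2⟩ <;>
    obtain ⟨j, s, h3, h4, h5 | h5⟩ := h2.exists_fract
  · refine key (k + 1) j 2 ?_
    rw [edge_coords]
    exact mem_openSegment_pt_of_coords (1 - s) (by linarith) (by linarith)
      (by rw [h1]; push_cast; ring) (by rw [h5]; ring)
  · refine key k j 5 ?_
    rw [edge_coords]
    exact mem_openSegment_pt_of_coords s h3 h4 (by rw [h1]; ring) (by rw [h5]; ring)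
  · refine key j (k + 1) 4 ?_
    rw [edge_coords]
    exact mem_openSegment_pt_of_coords s h3 h4 (by rw [h5]; ring) (by rw [h1]; push_cast; ring)
  · refine key j k 1 ?_
    rw [edge_coords]
    exact mem_openSegment_pt_of_coords (1 - s) (by linarith) (by linarith)
      (by rw [h5]; ring) (by rw [h1]; ring)
  · refine key j (k - j) 0 ?_
    rw [edge_coords]
    exact mem_openSegment_pt_of_coords (1 - s) (by linarith) (by linarith)
      (by rw [h5]; ring) (by push_cast; linarith)
  · refine key j (k + 1 - j) 3 ?_
    rw [edge_coords]
    exact mem_openSegment_pt_of_coords s h3 h4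
      (by rw [h5]; ring) (by push_cast; linarith)

theorem edges_disjoint {z : ℂ} : ¬ (z ∈ edgesX ∧ z ∈ edgesY) ∧ ¬ (z ∈ edgesX ∧ z ∈ edgesW) ∧
    ¬ (z ∈ edgesY ∧ z ∈ edgesW) := by
  refine ⟨fun h => h.1.1.not_notInt h.2.2, fun h => h.1.1.not_notInt h.2.2, fun h => ?_⟩
  obtain ⟨k, hk⟩ := h.1.1
  obtain ⟨j, hj⟩ := h.2.1
  exact h.2.2 (2 * j - 2 * k) (by push_cast; linarith)

theorem Refracts.exists_edge {A B C : ℂ} (h : Refracts A B C) :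
    ∃ e, B ∈ openSegment ℝ (edgeStart e) (edgeEnd e) :=
  Trihexagonal.exists_edge (h.imp And.left (Or.imp And.left And.left))

theorem Refracts.sameRay {A B C : ℂ} (h : Refracts A B C) (e : EdgeIndex)
    (he : B ∈ openSegment ℝ (edgeStart e) (edgeEnd e)) :
    SameRay ℝ (refract e (B - A)) (C - B) := by
  obtain ⟨a, b, k⟩ := e
  have h1 := openSegment_edge_subset a b k he
  obtain ⟨d1, d2, d3⟩ := edges_disjoint (z := B)
  rw [refract_cases]
  unfold Refracts at h
  fin_cases k <;> simp only [Fin.reduceFinMk, Fin.isValue, Fin.zero_eta, Fin.mk_one,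
    Matrix.cons_val] at h1 ⊢ <;>
    rcases h with ⟨h2, h3⟩ | ⟨h2, h3⟩ | ⟨h2, h3⟩ <;>
    first
    | exact h3
    | exact (d1 ⟨h1, h2⟩).elim
    | exact (d1 ⟨h2, h1⟩).elim
    | exact (d2 ⟨h1, h2⟩).elim
    | exact (d2 ⟨h2, h1⟩).elim
    | exact (d3 ⟨h1, h2⟩).elim
    | exact (d3 ⟨h2, h1⟩).elim

/-- The point with first coordinate `x` on the line of offset `t`, for the slope `α`. -/
noncomputable def chord (α t x : ℝ) : ℂ := pt x (t - (1 - α) * x)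

/-- The first coordinate of the point where the line of offset `t` enters the central hexagon. -/
noncomputable def entryX (α t : ℝ) : ℝ := max (-1) ((t - 1) / (1 - α))

/-- The first coordinate of the point where the line of offset `t` leaves the central hexagon. -/
noncomputable def exitX (α t : ℝ) : ℝ := min 1 ((1 - t) / α)

/-- The point where the line of offset `t` enters the central hexagon. -/
noncomputable def entry (α t : ℝ) : ℂ := chord α t (entryX α t)

/-- The point where the line of offset `t` leaves the central hexagon. -/
noncomputable def exit (α t : ℝ) : ℂ := chord α t (exitX α t)

/-- The offset `t` of a line is followed by `t'`, and half the centre of the next hexagon is `σ`: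
the crossed triangle lies at an edge of direction `ζ` or `ζ²`. -/
def IsStep (α t t' : ℝ) (σ : ℂ) : Prop :=
  (t < 1 - α ∧ t' = t + α ∧ σ = 1) ∨ (1 - α < t ∧ t' = t - (1 - α) ∧ σ = zeta)

section Local

variable {α t t' : ℝ} {σ : ℂ}

theorem chord_sub_chord (α t x x' : ℝ) :
    chord α t x' - chord α t x = ((x' - x : ℝ) : ℂ) * pt 1 (-(1 - α)) := by
  simp only [chord, pt]
  push_cast
  ring

theorem entryX_of_le (hα : α < 1) (h : t ≤ α) : entryX α t = -1 := by
  have : 0 < 1 - α := by linarith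
  rw [entryX, max_eq_left]
  rw [div_le_iff₀ this]
  linarith

theorem entryX_of_ge (hα : α < 1) (h : α ≤ t) : entryX α t = (t - 1) / (1 - α) := by
  have : 0 < 1 - α := by linarith
  rw [entryX, max_eq_right]
  rw [le_div_iff₀ this]
  linarith

theorem exitX_of_le (hα : 0 < α) (h : t ≤ 1 - α) : exitX α t = 1 := by
  rw [exitX, min_eq_left]
  rw [le_div_iff₀ hα]
  linarith

theorem exitX_of_ge (hα : 0 < α) (h : 1 - α ≤ t) : exitX α t = (1 - t) / α := by
  rw [exitX, min_eq_right]
  rw [div_le_iff₀ hα]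
  linarith

theorem entry_of_le (hα : α < 1) (h : t ≤ α) : entry α t = pt (-1) (t + (1 - α)) := by
  rw [entry, entryX_of_le hα h, chord]
  congr 1; ring

theorem entry_of_ge (hα : α < 1) (h : α ≤ t) : entry α t = pt ((t - 1) / (1 - α)) 1 := by
  have : 1 - α ≠ 0 := by linarith
  rw [entry, entryX_of_ge hα h, chord, mul_div_cancel₀ _ this]
  congr 1; ring

theorem exit_of_le (hα : 0 < α) (h : t ≤ 1 - α) : exit α t = pt 1 (t - (1 - α)) := by
  rw [exit, exitX_of_le hα h, chord]
  congr 1; ring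

theorem exit_of_ge (hα : 0 < α) (h : 1 - α ≤ t) :
    exit α t = pt ((1 - t) / α) (1 - (1 - t) / α) := by
  rw [exit, exitX_of_ge hα h, chord]
  congr 1; field_simp; ring

theorem entryX_neg (hα : α < 1) (ht : t < 1) : entryX α t < 0 :=
  max_lt (by norm_num) (div_neg_of_neg_of_pos (by linarith) (by linarith))

theorem exitX_pos (hα : 0 < α) (ht : t < 1) : 0 < exitX α t :=
  lt_min (by norm_num) (div_pos (by linarith) hα)

theorem entry_mem_edges (hα : α < 1) (h0 : 0 < t) (h1 : t < 1) (hne : t ≠ α) :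
    entry α t ∈ edgesX ∨ entry α t ∈ edgesY := by
  have hβ : 0 < 1 - α := by linarith
  rcases lt_or_gt_of_ne hne with h | h
  · left
    rw [entry_of_le hα h.le]
    refine ⟨⟨-1, by simp; norm_num⟩, ?_⟩
    rw [cy_pt]
    exact notInt_of_mem 0 (by push_cast; constructor <;> linarith)
  · right
    rw [entry_of_ge hα h.le]
    refine ⟨⟨0, by simp⟩, ?_⟩
    rw [cx_pt]
    refine notInt_of_mem (-1) ⟨?_, ?_⟩
    · rw [lt_div_iff₀ hβ]; push_cast; linarith
    · rw [div_lt_iff₀ hβ]; push_cast; linarith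

theorem next_entry_of_lt (hα : α < 1) (h0 : 0 < t) (ht : t < 1 - α) :
    omega * entry α (t + α) + 2 * 1 = pt (2 - t / (1 - α)) (t / (1 - α) - 1) := by
  have hβ : 1 - α ≠ 0 := by linarith
  rw [entry_of_ge hα (by linarith), omega_mul_pt,
    show (t + α - 1) / (1 - α) = t / (1 - α) - 1 by field_simp; ring]
  simp only [pt]; push_cast; ring

theorem next_entry_of_gt (hα : α < 1) (h1 : t < 1) :
    omega * entry α (t - (1 - α)) + 2 * zeta = pt (1 - t) 1 := by
  rw [entry_of_le hα (by linarith), omega_mul_pt]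
  simp only [pt]; push_cast; ring

theorem refX_real_mul (r : ℝ) (v : ℂ) : refX (r * v) = r * refX v := by
  simp only [refX, cx_real_mul, cy_real_mul, pt]; push_cast; ring

theorem refW_real_mul (r : ℝ) (v : ℂ) : refW (r * v) = r * refW v := by
  simp only [refW, cx_real_mul, cy_real_mul, pt]; push_cast; ring

theorem sameRay_real_mul {r s : ℝ} (hr : 0 ≤ r) (hs : 0 ≤ s) (v : ℂ) :
    SameRay ℝ ((r : ℂ) * v) ((s : ℂ) * v) := by
  rw [← Complex.real_smul, ← Complex.real_smul]
  exact ((SameRay.refl v).nonneg_smul_left hr).nonneg_smul_right hs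

theorem refracts_exit (hα0 : 0 < α) (hα : α < 1) (h0 : 0 < t) (h1 : t < 1)
    (hs : IsStep α t t' σ) :
    Refracts (entry α t) (exit α t) (omega * entry α t' + 2 * σ) := by
  have hβ : 0 < 1 - α := by linarith
  have hpos : 0 ≤ exitX α t - entryX α t := by
    linarith [entryX_neg hα h1, exitX_pos hα0 h1]
  have hd : exit α t - entry α t = _ := chord_sub_chord α t (entryX α t) (exitX α t)
  rcases hs with ⟨ht, rfl, rfl⟩ | ⟨ht, rfl, rfl⟩
  · left
    rw [hd, refX_real_mul, next_entry_of_lt hα h0 ht, exit_of_le hα0 ht.le]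
    refine ⟨⟨⟨0, by simp⟩, ?_⟩, ?_⟩
    · rw [cy_pt]
      exact notInt_of_mem (-1) (by push_cast; constructor <;> linarith)
    · have : pt (2 - t / (1 - α)) (t / (1 - α) - 1) - pt 1 (t - (1 - α)) =
          ((1 - t / (1 - α) : ℝ) : ℂ) * refX (pt 1 (-(1 - α))) := by
        apply ext_coords
        · rw [cx_real_mul]; simp [refX]; ring
        · rw [cy_real_mul]; simp [refX]; field_simp; ring
      rw [this]
      refine sameRay_real_mul hpos ?_ _
      rw [sub_nonneg, div_le_one hβ]
      exact ht.le
  · right; right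
    rw [hd, refW_real_mul, next_entry_of_gt hα h1, exit_of_ge hα0 ht.le]
    refine ⟨⟨⟨0, by simp⟩, ?_⟩, ?_⟩
    · rw [cx_pt]
      refine notInt_of_mem 0 ⟨?_, ?_⟩
      · push_cast; exact div_pos (by linarith) hα0
      · push_cast; rw [div_lt_iff₀ hα0]; linarith
    · have : pt (1 - t) 1 - pt ((1 - t) / α) (1 - (1 - t) / α) =
          (((1 - t) / α : ℝ) : ℂ) * refW (pt 1 (-(1 - α))) := by
        apply ext_coords
        · rw [cx_real_mul]; simp [refW]; field_simp
        · rw [cy_real_mul]; simp [refW]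
      rw [this]
      exact sameRay_real_mul hpos (div_nonneg (by linarith) hα0.le) _

theorem refracts_next_entry (hα0 : 0 < α) (hα : α < 1) (h0 : 0 < t) (h1 : t < 1)
    (hs : IsStep α t t' σ) :
    Refracts (exit α t) (omega * entry α t' + 2 * σ) (omega * exit α t' + 2 * σ) := by
  have hβ : 0 < 1 - α := by linarith
  have ht' : t' < 1 := by
    rcases hs with ⟨ht, rfl, rfl⟩ | ⟨ht, rfl, rfl⟩ <;> linarith
  have hpos : 0 ≤ exitX α t' - entryX α t' := by
    linarith [entryX_neg hα ht', exitX_pos hα0 ht']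
  have hd : exit α t' - entry α t' = _ := chord_sub_chord α t' (entryX α t') (exitX α t')
  have hd' : (omega * exit α t' + 2 * σ) - (omega * entry α t' + 2 * σ) =
      ((exitX α t' - entryX α t' : ℝ) : ℂ) * pt (-α) 1 := by
    rw [add_sub_add_right_eq_sub, ← mul_sub, hd, mul_left_comm, omega_mul_pt]
    congr 2; ring
  rw [Refracts, hd']
  rcases hs with ⟨ht, rfl, rfl⟩ | ⟨ht, rfl, rfl⟩
  · right; right
    rw [next_entry_of_lt hα h0 ht, exit_of_le hα0 ht.le]
    refine ⟨⟨⟨0, by simp; ring⟩, ?_⟩, ?_⟩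
    · rw [cx_pt]
      have h2 : t / (1 - α) < 1 := by rw [div_lt_one hβ]; exact ht
      have h3 : 0 < t / (1 - α) := div_pos h0 hβ
      exact notInt_of_mem 1 (by push_cast; constructor <;> linarith)
    · have : refW (pt (2 - t / (1 - α)) (t / (1 - α) - 1) - pt 1 (t - (1 - α))) =
          ((1 - t / (1 - α) : ℝ) : ℂ) * pt (-α) 1 := by
        apply ext_coords
        · rw [cx_real_mul]; simp [refW]; field_simp; ring
        · rw [cy_real_mul]; simp [refW]; ring
      rw [this]
      refine sameRay_real_mul ?_ hpos _
      rw [sub_nonneg, div_le_one hβ]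
      exact ht.le
  · right; left
    rw [next_entry_of_gt hα h1, exit_of_ge hα0 ht.le]
    refine ⟨⟨⟨0, by simp⟩, ?_⟩, ?_⟩
    · rw [cx_pt]
      exact notInt_of_mem 0 (by push_cast; constructor <;> linarith)
    · have : refY (pt (1 - t) 1 - pt ((1 - t) / α) (1 - (1 - t) / α)) =
          (((1 - t) / α : ℝ) : ℂ) * pt (-α) 1 := by
        apply ext_coords
        · rw [cx_real_mul]; simp [refY]; field_simp; ring
        · rw [cy_real_mul]; simp [refY]
      rw [this]
      exact sameRay_real_mul (div_nonneg (by linarith) hα0.le) hpos _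

theorem convex_strict_bounds {a b l h s u : ℝ} (hs : 0 < s) (hu : 0 < u) (hsu : s + u = 1)
    (hla : l ≤ a) (hah : a ≤ h) (hlb : l < b) (hbh : b ≤ h) (hh : a < h ∨ b < h) :
    l < s * a + u * b ∧ s * a + u * b < h := by
  obtain rfl : s = 1 - u := by linarith
  constructor
  · nlinarith [mul_nonneg hs.le (sub_nonneg.2 hla), mul_pos hu (sub_pos.2 hlb)]
  · rcases hh with hh | hh
    · nlinarith [mul_pos hs (sub_pos.2 hh), mul_nonneg hu.le (sub_nonneg.2 hbh)]
    · nlinarith [mul_nonneg hs.le (sub_nonneg.2 hah), mul_pos hu (sub_pos.2 hh)]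

theorem entry_bounds (hα0 : 0 < α) (hα : α < 1) (h0 : 0 < t) (h1 : t < 1) :
    -1 ≤ cx (entry α t) ∧ cx (entry α t) < 0 ∧ 0 < cy (entry α t) ∧ cy (entry α t) ≤ 1 ∧
      -1 ≤ cx (entry α t) + cy (entry α t) ∧ cx (entry α t) + cy (entry α t) < 1 := by
  have hβ : 0 < 1 - α := by linarith
  rcases le_total t α with h | h
  · rw [entry_of_le hα h, cx_pt, cy_pt]
    refine ⟨?_, ?_, ?_, ?_, ?_, ?_⟩ <;> linarith
  · have h2 : -1 ≤ (t - 1) / (1 - α) := by rw [le_div_iff₀ hβ]; linarith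
    have h3 : (t - 1) / (1 - α) < 0 := div_neg_of_neg_of_pos (by linarith) hβ
    rw [entry_of_ge hα h, cx_pt, cy_pt]
    refine ⟨?_, ?_, ?_, ?_, ?_, ?_⟩ <;> linarith

theorem exit_bounds (hα0 : 0 < α) (hα : α < 1) (h0 : 0 < t) (h1 : t < 1) :
    0 < cx (exit α t) ∧ cx (exit α t) ≤ 1 ∧ -1 < cy (exit α t) ∧ cy (exit α t) < 1 ∧
      0 < cx (exit α t) + cy (exit α t) ∧ cx (exit α t) + cy (exit α t) ≤ 1 := by
  rcases le_total t (1 - α) with h | h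
  · rw [exit_of_le hα0 h, cx_pt, cy_pt]
    refine ⟨?_, ?_, ?_, ?_, ?_, ?_⟩ <;> linarith
  · have h2 : (1 - t) / α ≤ 1 := by rw [div_le_iff₀ hα0]; linarith
    have h3 : 0 < (1 - t) / α := div_pos (by linarith) hα0
    rw [exit_of_ge hα0 h, cx_pt, cy_pt]
    refine ⟨?_, ?_, ?_, ?_, ?_, ?_⟩ <;> linarith

theorem disjoint_hexagon_chord (hα0 : 0 < α) (hα : α < 1) (h0 : 0 < t) (h1 : t < 1) :
    Disjoint (openSegment ℝ (entry α t) (exit α t)) lines := by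
  rw [Set.disjoint_left]
  rintro z ⟨s, u, hs, hu, hsu, rfl⟩ hz
  obtain ⟨e1, e2, e3, e4, e5, e6⟩ := entry_bounds hα0 hα h0 h1
  obtain ⟨o1, o2, o3, o4, o5, o6⟩ := exit_bounds hα0 hα h0 h1
  simp only [lines, Set.mem_ofPred_eq, map_add, map_smul, smul_eq_mul] at hz
  rcases hz with hz | hz | hz
  · exact not_isOdd_of_mem (convex_strict_bounds hs hu hsu e1 (by linarith) (by linarith) o2
      (Or.inl (by linarith))) hz
  · exact not_isOdd_of_mem (convex_strict_bounds hs hu hsu (by linarith) e4 o3 o4.le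
      (Or.inr o4)) hz
  · rw [show ∀ a b c d : ℝ, s * a + u * b + (s * c + u * d) = s * (a + c) + u * (b + d) by
      intros; ring] at hz
    exact not_isOdd_of_mem (convex_strict_bounds hs hu hsu e5 e6.le (by linarith) o6
      (Or.inl e6)) hz

theorem disjoint_triangle_chord (hα0 : 0 < α) (hα : α < 1) (h0 : 0 < t) (h1 : t < 1)
    (hs : IsStep α t t' σ) :
    Disjoint (openSegment ℝ (exit α t) (omega * entry α t' + 2 * σ)) lines := by
  have hβ : 0 < 1 - α := by linarith
  have hsum : ∀ s u a b c d : ℝ,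
    s * a + u * b + (s * c + u * d) = s * (a + c) + u * (b + d) := by intros; ring
  rw [Set.disjoint_left]
  rintro z ⟨s, u, hs', hu, hsu, rfl⟩ hz
  rcases hs with ⟨ht, rfl, rfl⟩ | ⟨ht, rfl, rfl⟩
  · have h2 : t / (1 - α) < 1 := by rw [div_lt_one hβ]; exact ht
    have h3 : 0 < t / (1 - α) := div_pos h0 hβ
    rw [next_entry_of_lt hα h0 ht, exit_of_le hα0 ht.le] at hz
    simp only [lines, Set.mem_ofPred_eq, map_add, map_smul, smul_eq_mul, cx_pt, cy_pt] at hz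
    rcases hz with hz | hz | hz
    · refine not_isOdd_of_mem' (convex_strict_bounds hs' hu hsu ?_ ?_ ?_ ?_ (Or.inl ?_)) hz <;>
        linarith
    · refine not_isOdd_of_mem (convex_strict_bounds hs' hu hsu ?_ ?_ ?_ ?_ (Or.inl ?_)) hz <;>
        linarith
    · rw [hsum] at hz
      refine not_isOdd_of_mem (convex_strict_bounds hs' hu hsu ?_ ?_ ?_ ?_ (Or.inl ?_)) hz <;>
        linarith
  · have h2 : (1 - t) / α < 1 := by rw [div_lt_iff₀ hα0]; linarith
    have h3 : 0 < (1 - t) / α := div_pos (by linarith) hα0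
    rw [next_entry_of_gt hα h1, exit_of_ge hα0 ht.le] at hz
    simp only [lines, Set.mem_ofPred_eq, map_add, map_smul, smul_eq_mul, cx_pt, cy_pt] at hz
    rcases hz with hz | hz | hz
    · refine not_isOdd_of_mem (convex_strict_bounds hs' hu hsu ?_ ?_ ?_ ?_ (Or.inl ?_)) hz <;>
        linarith
    · refine not_isOdd_of_mem (convex_strict_bounds hs' hu hsu ?_ ?_ ?_ ?_ (Or.inl ?_)) hz <;>
        linarith
    · rw [hsum] at hz
      refine not_isOdd_of_mem' (convex_strict_bounds hs' hu hsu ?_ ?_ ?_ ?_ (Or.inl ?_)) hz <;>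
        linarith

end Local

/-- The offset of a trajectory after `n` steps. -/
noncomputable def offset (θ : ℝ × ℝ) (n : ℕ) : ℝ := Int.fract (θ.2 + n * θ.1)

theorem offset_lt_one (θ : ℝ × ℝ) (n : ℕ) : offset θ n < 1 := Int.fract_lt_one _

/-- Half the centre of the next hexagon, relative to the current one. -/
noncomputable def hop (θ : ℝ × ℝ) (n : ℕ) : ℂ :=
  1 + omega * ((height θ (n + 1) - height θ n : ℤ) : ℂ)

/-- The trajectory with slope and offset given by `θ`. -/
noncomputable def path (θ : ℝ × ℝ) (i : ℕ) : ℂ :=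
  motion (i / 2) (cocycle θ (i / 2))
    (if i % 2 = 0 then entry θ.1 (offset θ (i / 2)) else exit θ.1 (offset θ (i / 2)))

/-- The parameters of the trajectories that do not meet vertices. -/
structure IsGeneric (θ : ℝ × ℝ) : Prop where
  pos : 0 < θ.1
  lt_one : θ.1 < 1
  ne : ∀ k j : ℤ, θ.2 + k * θ.1 ≠ j

theorem motion_succ (θ : ℝ × ℝ) (n : ℕ) (z : ℂ) :
    motion (n + 1) (cocycle θ (n + 1)) z =
      motion n (cocycle θ n) (omega * z + 2 * hop θ n) := by
  rw [motion, motion, cocycle, Finset.sum_range_succ, ← cocycle, hop]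
  ring

theorem path_even (θ : ℝ × ℝ) (n : ℕ) :
    path θ (2 * n) = motion n (cocycle θ n) (entry θ.1 (offset θ n)) := by
  simp [path]

theorem path_odd (θ : ℝ × ℝ) (n : ℕ) :
    path θ (2 * n + 1) = motion n (cocycle θ n) (exit θ.1 (offset θ n)) := by
  rw [path, show (2 * n + 1) / 2 = n by omega, if_neg (by omega)]

theorem path_even_succ (θ : ℝ × ℝ) (n : ℕ) :
    path θ (2 * n + 2) = motion n (cocycle θ n)
      (omega * entry θ.1 (offset θ (n + 1)) + 2 * hop θ n) := by
  rw [← motion_succ, ← path_even]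
  rfl

theorem path_odd_succ (θ : ℝ × ℝ) (n : ℕ) :
    path θ (2 * n + 3) = motion n (cocycle θ n)
      (omega * exit θ.1 (offset θ (n + 1)) + 2 * hop θ n) := by
  rw [← motion_succ, ← path_odd]
  rfl

namespace IsGeneric

theorem offset_pos {θ : ℝ × ℝ} (hθ : IsGeneric θ) (n : ℕ) : 0 < offset θ n := by
  refine lt_of_le_of_ne (Int.fract_nonneg _) fun h => ?_
  have h1 := Int.self_sub_floor (θ.2 + n * θ.1)
  rw [← offset, ← h] at h1
  exact hθ.ne n ⌊θ.2 + n * θ.1⌋ (by push_cast; linarith)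

theorem offset_zero_ne {θ : ℝ × ℝ} (hθ : IsGeneric θ) : offset θ 0 ≠ θ.1 := by
  intro h
  have h1 := Int.self_sub_floor (θ.2 + (0 : ℕ) * θ.1)
  rw [← offset, h] at h1
  exact hθ.ne (-1) ⌊θ.2 + (0 : ℕ) * θ.1⌋ (by push_cast at h1 ⊢; linarith)

theorem isStep {θ : ℝ × ℝ} (hθ : IsGeneric θ) (n : ℕ) : IsStep θ.1 (offset θ n) (offset θ (n + 1)) (hop θ n) := by
  have h0 := hθ.offset_pos n
  have h1 := offset_lt_one θ n
  have hα0 := hθ.pos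
  have hα := hθ.lt_one
  have hs : θ.2 + (n + 1 : ℕ) * θ.1 = height θ n + (offset θ n + θ.1) := by
    have := Int.floor_add_fract (θ.2 + n * θ.1)
    rw [height, offset]
    push_cast
    linarith
  have hne : offset θ n ≠ 1 - θ.1 := by
    intro h
    exact hθ.ne (n + 1) (height θ n + 1) (by push_cast at hs ⊢; linarith)
  rcases lt_or_gt_of_ne hne with h | h
  · left
    have hfl : height θ (n + 1) = height θ n := by
      conv_lhs => rw [height, hs]
      rw [Int.floor_eq_iff]
      constructor <;> linarith
    refine ⟨h, ?_, by rw [hop, hfl]; simp⟩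
    rw [offset, Int.fract, ← height, hfl, hs]
    ring
  · right
    have hfl : height θ (n + 1) = height θ n + 1 := by
      conv_lhs => rw [height, hs]
      rw [Int.floor_eq_iff]
      push_cast
      constructor <;> linarith
    refine ⟨h, ?_, by rw [hop, hfl, zeta_eq]; simp⟩
    rw [offset, Int.fract, ← height, hfl, hs]
    push_cast
    ring

theorem refracts {θ : ℝ × ℝ} (hθ : IsGeneric θ) (i : ℕ) : Refracts (path θ i) (path θ (i + 1)) (path θ (i + 2)) := by
  obtain ⟨n, rfl | rfl⟩ := i.even_or_odd'
  · rw [path_even, path_odd, path_even_succ]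
    exact (refracts_exit hθ.pos hθ.lt_one (hθ.offset_pos n) (offset_lt_one θ n)
      (hθ.isStep n)).motion (isEisenstein_cocycle θ n) n
  · rw [path_odd, path_even_succ, path_odd_succ]
    exact (refracts_next_entry hθ.pos hθ.lt_one (hθ.offset_pos n) (offset_lt_one θ n)
      (hθ.isStep n)).motion (isEisenstein_cocycle θ n) n

end IsGeneric

theorem motion_segment {n : ℕ} {x A B z : ℂ} {s u : ℝ} (hsu : s + u = 1)
    (h : s • motion n x A + u • motion n x B = z) : z = motion n x (s • A + u • B) := by
  have h' : (s : ℂ) + u = 1 := by exact_mod_cast hsu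
  rw [← h]
  simp only [motion, Complex.real_smul]
  linear_combination (2 * x) * h'

theorem disjoint_motion {A B x : ℂ} (hx : IsEisenstein x)
    (h : Disjoint (openSegment ℝ A B) lines) (n : ℕ) :
    Disjoint (openSegment ℝ (motion n x A) (motion n x B)) skeleton := by
  rw [Set.disjoint_left] at h ⊢
  rintro z ⟨s, u, hs, hu, hsu, hz⟩ hz'
  have h1 := skeleton_subset_lines hz'
  rw [motion_segment hsu hz] at h1
  exact h ⟨s, u, hs, hu, hsu, rfl⟩ (motion_mem_lines hx h1)

theorem IsGeneric.isTrajectory {θ : ℝ × ℝ} (hθ : IsGeneric θ) : IsTrajectory (path θ) := by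
  have hedge : ∀ i, ∃ e, path θ i ∈ openSegment ℝ (edgeStart e) (edgeEnd e) := by
    intro i
    rcases i with _ | i
    · have h := entry_mem_edges hθ.lt_one (hθ.offset_pos 0) (offset_lt_one θ 0)
        hθ.offset_zero_ne
      have h' : path θ 0 = entry θ.1 (offset θ 0) := by simp [path, motion, cocycle]
      rw [h']
      exact exists_edge (h.imp id Or.inl)
    · exact (hθ.refracts i).exists_edge
  have hin : ∀ i, Disjoint (openSegment ℝ (path θ i) (path θ (i + 1))) skeleton := by
    intro i
    obtain ⟨n, rfl | rfl⟩ := i.even_or_odd'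
    · rw [path_even, path_odd]
      exact disjoint_motion (isEisenstein_cocycle θ n) (disjoint_hexagon_chord hθ.pos hθ.lt_one
        (hθ.offset_pos n) (offset_lt_one θ n)) n
    · rw [path_odd, path_even_succ]
      exact disjoint_motion (isEisenstein_cocycle θ n) (disjoint_triangle_chord hθ.pos hθ.lt_one
        (hθ.offset_pos n) (offset_lt_one θ n) (hθ.isStep n)) n
  refine ⟨hedge, fun i h => ?_, hin, fun i e he => (hθ.refracts i).sameRay e he⟩
  obtain ⟨e, he⟩ := hedge i
  have h1 := hin i
  rw [← h, openSegment_same, Set.disjoint_singleton_left] at h1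
  exact h1 (Set.mem_iUnion.2 ⟨e, openSegment_subset_segment _ _ _ he⟩)

theorem chord_mem_segment {α t a b x : ℝ} (hab : a < b) (hax : a ≤ x) (hxb : x ≤ b) :
    chord α t x ∈ segment ℝ (chord α t a) (chord α t b) := by
  have h : 0 < b - a := by linarith
  refine ⟨(b - x) / (b - a), (x - a) / (b - a), div_nonneg (by linarith) h.le,
    div_nonneg (by linarith) h.le, by field_simp; ring, ?_⟩
  apply ext_coords
  · simp only [chord, map_add, map_smul, smul_eq_mul, cx_pt]
    field_simp; ring
  · simp only [chord, map_add, map_smul, smul_eq_mul, cy_pt]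
    field_simp; ring

theorem mem_segment_entry_exit {α t : ℝ} (hα0 : 0 < α) (hα : α < 1) (h1 : t < 1) {z : ℂ}
    (ht : (1 - α) * cx z + cy z = t) (hx1 : -1 ≤ cx z) (hx2 : cx z ≤ 1) (hy : cy z ≤ 1)
    (hw : cx z + cy z ≤ 1) : z ∈ segment ℝ (entry α t) (exit α t) := by
  have hβ : 0 < 1 - α := by linarith
  have hz : z = chord α t (cx z) := by
    rw [chord, ← ht, add_sub_cancel_left, pt_coords]
  rw [hz]
  refine chord_mem_segment ((entryX_neg hα h1).trans (exitX_pos hα0 h1)) (max_le hx1 ?_)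
    (le_min hx2 ?_)
  · rw [div_le_iff₀ hβ]; linarith
  · rw [le_div_iff₀ hα0]; linarith

theorem mem_segment_exit_next_entry {α t : ℝ} (hα : α < 1) (hα0 : 0 < α) (h0 : 0 < t)
    (h1 : t < 1 - α) {z : ℂ} (ht : α * (cx z - 1) + cy z + (1 - α) = t) (hx : 1 ≤ cx z)
    (hw : cx z + cy z ≤ 1) :
    z ∈ segment ℝ (exit α t) (omega * entry α (t + α) + 2 * 1) := by
  have hβ : 0 < 1 - α := by linarith
  have hD : 0 < (1 - α) - t := by linarith
  rw [next_entry_of_lt hα h0 h1, exit_of_le hα0 h1.le]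
  have hs : (cx z - 1) * (1 - α) ≤ (1 - α) - t := by
    rw [← ht]; linarith
  refine ⟨1 - (cx z - 1) * (1 - α) / ((1 - α) - t), (cx z - 1) * (1 - α) / ((1 - α) - t), ?_, ?_,
    by ring, ?_⟩
  · rw [sub_nonneg, div_le_one hD]; exact hs
  · exact div_nonneg (mul_nonneg (by linarith) hβ.le) hD.le
  · apply ext_coords
    · simp only [map_add, map_smul, smul_eq_mul, cx_pt]
      field_simp; ring
    · have hy : cy z = t - (1 - α) - α * (cx z - 1) := by linarith
      simp only [map_add, map_smul, smul_eq_mul, cy_pt, hy]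
      field_simp; ring

theorem motion_mem_segment {A B z : ℂ} (h : z ∈ segment ℝ A B) (n : ℕ) (x : ℂ) :
    motion n x z ∈ segment ℝ (motion n x A) (motion n x B) := by
  obtain ⟨s, u, hs, hu, hsu, rfl⟩ := h
  exact ⟨s, u, hs, hu, hsu, motion_segment hsu rfl⟩

theorem norm_zeta : ‖zeta‖ = 1 := by
  have h := normSq_zeta_pow 1
  rw [pow_one] at h
  have h1 : ‖zeta‖ ^ 2 = 1 := by
    rw [← Complex.normSq_eq_norm_sq, Complex.normSq_apply]; linarith
  nlinarith [norm_nonneg zeta]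

theorem dist_motion (n : ℕ) (x z : ℂ) (r : ℝ) :
    dist (motion n x z) (motion n x (z + r * zeta)) = |r| := by
  rw [dist_eq_norm, motion, motion, show omega ^ n * z + 2 * x - (omega ^ n * (z + r * zeta) + 2 * x)
    = -(omega ^ n * (r * zeta)) by ring, norm_neg, norm_mul, norm_pow, omega, norm_pow, norm_mul,
    norm_zeta]
  simp

/-- The trajectory visits all hexagons in all possible directions, with a dense set of offsets. -/
def IsTransitive (θ : ℝ × ℝ) : Prop :=
  ∀ c < 3, ∀ z, IsEisenstein z → ∀ a b : ℝ, 0 ≤ a → a < b → b ≤ 1 →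
    ∃ n : ℕ, n % 3 = c ∧ cocycle θ n = z ∧ offset θ n ∈ Set.Ioo a b

theorem IsTransitive.motion_mem_closure_trace {θ : ℝ × ℝ} (hθ : IsTransitive θ) {c : ℕ}
    (hc : c < 3) {x : ℂ} (hx : IsEisenstein x) {z : ℂ} {t d : ℝ} (ht : 0 ≤ t) (hd : 0 < d)
    (htd : t + d ≤ 1)
    (h : ∀ n, t < offset θ n → offset θ n < t + d → cocycle θ n = x →
      motion n x (z + (offset θ n - t : ℝ) * zeta) ∈ trace (path θ)) :
    motion c x z ∈ closure (trace (path θ)) := by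
  rw [Metric.mem_closure_iff]
  intro ε hε
  obtain ⟨n, hn, hx', h1, h2⟩ := hθ c hc x hx t (t + min d ε) ht
    (by linarith [lt_min hd hε]) (by linarith [min_le_left d ε])
  refine ⟨_, h n h1 (by linarith [min_le_left d ε]) hx', ?_⟩
  have hc' : motion c x z = motion n x z := by
    rw [motion, motion, omega_pow_eq (m := c) (n := n) (by omega)]
  rw [hc', dist_motion, abs_of_pos (by linarith)]
  linarith [min_le_right d ε]

variable {θ : ℝ × ℝ}

theorem motion_mem_closure_of_mem_hexagon (hg : IsGeneric θ) (hθ : IsTransitive θ) {c : ℕ}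
    (hc : c < 3) {x : ℂ} (hx : IsEisenstein x) {z : ℂ} (ht : 0 < (1 - θ.1) * cx z + cy z)
    (hx1 : -1 < cx z) (hx2 : cx z < 1) (hy : cy z < 1) (hw : cx z + cy z < 1) :
    motion c x z ∈ closure (trace (path θ)) := by
  have hα0 := hg.pos
  have hα := hg.lt_one
  have ht1 : (1 - θ.1) * cx z + cy z < 1 := by
    nlinarith [mul_pos (sub_pos.2 hα) (sub_pos.2 hw), mul_pos hα0 (sub_pos.2 hy)]
  set t := (1 - θ.1) * cx z + cy z with ht'
  refine hθ.motion_mem_closure_trace hc hx ht.le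
    (d := min (1 - t) (min (1 - cy z) (1 - (cx z + cy z))))
    (lt_min (by linarith) (lt_min (by linarith) (by linarith)))
    (by linarith [min_le_left (1 - t) (min (1 - cy z) (1 - (cx z + cy z)))]) ?_
  intro n h1 h2 hn
  have hm1 := min_le_right (1 - t) (min (1 - cy z) (1 - (cx z + cy z)))
  have hm2 := min_le_left (1 - cy z) (1 - (cx z + cy z))
  have hm3 := min_le_right (1 - cy z) (1 - (cx z + cy z))
  refine Set.mem_iUnion.2 ⟨2 * n, ?_⟩
  rw [path_even, path_odd, hn]
  refine motion_mem_segment (mem_segment_entry_exit hα0 hα (offset_lt_one θ n) ?_ ?_ ?_ ?_ ?_) n x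
  all_goals simp only [map_add, cx_real_mul, cy_real_mul, cx_zeta, cy_zeta]
  all_goals linarith

theorem motion_mem_closure_of_mem_triangle (hg : IsGeneric θ) (hθ : IsTransitive θ) {x : ℂ}
    (hx : IsEisenstein x) {z : ℂ} (hx1 : 1 < cx z) (hy : -(1 - θ.1) < cy z)
    (hw : cx z + cy z < 1) :
    motion 0 x z ∈ closure (trace (path θ)) := by
  have hα0 := hg.pos
  have hα := hg.lt_one
  have h0 : 0 < θ.1 * (cx z - 1) + cy z + (1 - θ.1) := by
    nlinarith [mul_pos hα0 (sub_pos.2 hx1)]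
  have h1 : θ.1 * (cx z - 1) + cy z + (1 - θ.1) < 1 - θ.1 := by
    nlinarith [mul_pos (sub_pos.2 hα) (sub_pos.2 hx1)]
  set t := θ.1 * (cx z - 1) + cy z + (1 - θ.1) with ht'
  refine hθ.motion_mem_closure_trace (by norm_num) hx h0.le
    (d := min (1 - θ.1 - t) (1 - (cx z + cy z))) (lt_min (by linarith) (by linarith))
    (by linarith [min_le_left (1 - θ.1 - t) (1 - (cx z + cy z))]) ?_
  intro n h2 h3 hn
  have hm1 := min_le_left (1 - θ.1 - t) (1 - (cx z + cy z))
  have hm2 := min_le_right (1 - θ.1 - t) (1 - (cx z + cy z))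
  have h4 : offset θ n < 1 - θ.1 := by linarith
  refine Set.mem_iUnion.2 ⟨2 * n + 1, ?_⟩
  rw [path_odd, path_even_succ, hn]
  obtain ⟨-, hs1, hs2⟩ : _ ∧ offset θ (n + 1) = offset θ n + θ.1 ∧ hop θ n = 1 :=
    (hg.isStep n).resolve_right fun h => by linarith [h.1]
  rw [hs1, hs2]
  refine motion_mem_segment
    (mem_segment_exit_next_entry hα hα0 (hg.offset_pos n) h4 ?_ ?_ ?_) n x
  all_goals simp only [map_add, cx_real_mul, cy_real_mul, cx_zeta, cy_zeta]
  all_goals linarith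

theorem mem_closure_of_mem_strip (hg : IsGeneric θ) (hθ : IsTransitive θ) {z : ℂ}
    (hy0 : -(1 - θ.1) < cy z) (hy1 : cy z < 0) (hx : ¬ IsOdd (cx z))
    (hw : ¬ IsOdd (cx z + cy z)) : z ∈ closure (trace (path θ)) := by
  have hα0 := hg.pos
  have hα := hg.lt_one
  set m : ℤ := ⌊(cx z + 1) / 2⌋ with hm
  have h1 := Int.floor_le ((cx z + 1) / 2)
  have h2 := Int.lt_floor_add_one ((cx z + 1) / 2)
  rw [← hm] at h1 h2
  have h3 : cx z ≠ 2 * m - 1 := fun h => hx ⟨m - 1, by push_cast; linarith⟩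
  have h4 : 2 * (m : ℝ) - 1 < cx z := lt_of_le_of_ne (by linarith) h3.symm
  have h5 : cx z + cy z ≠ 2 * m - 1 := fun h => hw ⟨m - 1, by push_cast; linarith⟩
  have hcx : ∀ k : ℤ, cx (z - 2 * k) = cx z - 2 * k := fun k => by
    rw [map_sub, show (2 * k : ℂ) = pt (2 * k) 0 by simp [pt], cx_pt]
  have hcy : ∀ k : ℤ, cy (z - 2 * k) = cy z := fun k => by
    rw [map_sub, show (2 * k : ℂ) = pt (2 * k) 0 by simp [pt], cy_pt, sub_zero]
  rcases lt_or_gt_of_ne h5 with h6 | h6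
  · have := motion_mem_closure_of_mem_triangle hg hθ (isEisenstein_intCast (m - 1))
      (z := z - 2 * (m - 1 : ℤ)) (by rw [hcx]; push_cast; linarith) (by rw [hcy]; exact hy0)
      (by rw [hcx, hcy]; push_cast; linarith)
    simpa [motion] using this
  · set w : ℂ := z - 2 * m with hwdef
    have hwx : cx w = cx z - 2 * m := hcx m
    have hwy : cy w = cy z := hcy m
    have hmot : ∀ c v, omega ^ c * v = w → motion c (m : ℂ) v = z := fun c v h => by
      rw [motion, h, hwdef]; ring
    have key := fun c (hc : c < 3) v (h : omega ^ c * v = w) =>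
      hmot c v h ▸ motion_mem_closure_of_mem_hexagon hg hθ hc (isEisenstein_intCast m) (z := v)
    by_cases p0 : 0 < (1 - θ.1) * cx w + cy w
    · exact key 0 (by norm_num) w (by simp) p0 (by linarith) (by linarith) (by linarith)
        (by linarith)
    by_cases p1 : 0 < (1 - θ.1) * cx (omega * w) + cy (omega * w)
    · refine key 2 (by norm_num) (omega * w)
        (by linear_combination w * omega_cube) p1 ?_ ?_ ?_ ?_ <;>
        simp only [cx_omega_mul, cy_omega_mul] <;> linarith
    · refine key 1 (by norm_num) (omega * (omega * w))
        (by linear_combination w * omega_cube) ?_ ?_ ?_ ?_ ?_ <;>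
        simp only [cx_omega_mul, cy_omega_mul] at p1 ⊢
      · by_contra p2
        have e0 : (1 - θ.1) * cx w + cy w = 0 := by linarith
        have e1 : (1 - θ.1) * (-cx w - cy w) + cx w = 0 := by linarith
        have e2 : cx w * (1 - θ.1 + θ.1 ^ 2) = 0 := by
          linear_combination e1 + (1 - θ.1) * e0
        have e3 : cx w = 0 := by
          rcases mul_eq_zero.1 e2 with h | h
          · exact h
          · nlinarith
        rw [e3] at e0
        linarith
      all_goals linarith

theorem strip_subset_closure (hg : IsGeneric θ) (hθ : IsTransitive θ) :
    cy ⁻¹' Set.Ioo (-(1 - θ.1)) 0 ⊆ closure (trace (path θ)) := by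
  rintro z ⟨hy0, hy1⟩
  have hcount : ∀ r : ℝ, {s : ℝ | IsOdd (r + s)}.Countable := by
    intro r
    refine (Set.countable_range fun k : ℤ => (2 * k + 1 - r : ℝ)).mono ?_
    rintro s ⟨k, hk⟩
    exact ⟨k, by simp only; linarith⟩
  have hdense := ((hcount (cx z)).union (hcount (cx z + cy z))).dense_compl ℝ
  have hcont : Continuous fun s : ℝ => z + s := by fun_prop
  have hclosed : IsClosed ((fun s : ℝ => z + s) ⁻¹' closure (trace (path θ))) :=
    isClosed_closure.preimage hcont
  have hsub : ({s : ℝ | IsOdd (cx z + s)} ∪ {s : ℝ | IsOdd (cx z + cy z + s)})ᶜ ⊆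
      (fun s : ℝ => z + s) ⁻¹' closure (trace (path θ)) := by
    intro s hs
    have hx : cx (z + s) = cx z + s := by
      rw [map_add, show (s : ℂ) = pt s 0 by simp [pt], cx_pt]
    have hy : cy (z + s) = cy z := by
      rw [map_add, show (s : ℂ) = pt s 0 by simp [pt], cy_pt, add_zero]
    rw [Set.mem_compl_iff, Set.mem_union, not_or] at hs
    refine mem_closure_of_mem_strip hg hθ (by rwa [hy]) (by rwa [hy]) (by rw [hx]; exact hs.1) ?_
    rw [hx, hy, add_right_comm]
    exact hs.2
  have huniv := (hdense.mono hsub).closure_eq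
  rw [hclosed.closure_eq] at huniv
  have h0 : (0 : ℝ) ∈ (fun s : ℝ => z + s) ⁻¹' closure (trace (path θ)) := huniv ▸ Set.mem_univ _
  simpa using h0

theorem isOpen_strip (a b : ℝ) : IsOpen (cy ⁻¹' Set.Ioo a b) :=
  isOpen_Ioo.preimage (LinearMap.continuous_of_finiteDimensional cy)

theorem isConnected_strip {a b : ℝ} (hab : a < b) : IsConnected (cy ⁻¹' Set.Ioo a b) := by
  refine ⟨⟨pt 0 ((a + b) / 2), ?_⟩, ((convex_Ioo a b).linear_preimage cy).isPreconnected⟩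
  rw [Set.mem_preimage, cy_pt]
  constructor <;> linarith

theorem volume_strip {a b : ℝ} (hab : a < b) :
    MeasureTheory.volume (cy ⁻¹' Set.Ioo a b) = ⊤ := by
  have h3 : 0 < Real.sqrt 3 := by positivity
  have hset : cy ⁻¹' Set.Ioo a b = Complex.measurableEquivRealProd ⁻¹'
      (Set.univ ×ˢ Set.Ioo (a * Real.sqrt 3 / 2) (b * Real.sqrt 3 / 2)) := by
    ext z
    have h : cy z = 2 * z.im / Real.sqrt 3 := by
      simp [cy, div_eq_mul_inv]; ring
    simp only [Set.mem_preimage, Set.mem_Ioo, Set.mem_prod, Set.mem_univ, true_and, h,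
      Complex.measurableEquivRealProd_apply]
    rw [lt_div_iff₀ h3, div_lt_iff₀ h3, div_lt_iff₀ two_pos, lt_div_iff₀ two_pos]
    constructor <;> rintro ⟨h1, h2⟩ <;> constructor <;> linarith
  rw [hset, Complex.volume_preserving_equiv_real_prod.measure_preimage_equiv,
    MeasureTheory.Measure.volume_eq_prod, MeasureTheory.Measure.prod_prod, Real.volume_univ,
    Real.volume_Ioo]
  refine ENNReal.top_mul ?_
  rw [Ne, ENNReal.ofReal_eq_zero, not_le]
  nlinarith

end Trihexagonal

theorem theorem5p9 :
    ∃ p : ℕ → ℂ, Trihexagonal.IsTrajectory p ∧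
      ∃ R : Set ℂ, IsOpen R ∧ IsConnected R ∧ MeasureTheory.volume R = ⊤ ∧
        R ⊆ closure (Trihexagonal.trace p) := by
  obtain ⟨α, t, h0, h1, hne, htrans⟩ := Trihexagonal.exists_transitive_param
  have hg : Trihexagonal.IsGeneric (α, t) := ⟨h0, h1, hne⟩
  have hneg : -(1 - α) < 0 := by linarith
  exact ⟨Trihexagonal.path (α, t), hg.isTrajectory, _, Trihexagonal.isOpen_strip _ _,
    Trihexagonal.isConnected_strip hneg, Trihexagonal.volume_strip hneg,
    Trihexagonal.strip_subset_closure hg htrans⟩
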